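/- Let $(G_i)_{i\in I}$ be a family of groups, let $F$ be a free group, and let $G=F*\mathop{*}_{i\in I}G_i$ be their free product. Let $\mathcal F$ be the set of all finitely generated subgroups $H$ of $G$ such that $H\cap g^{-1}G_ig=\{1\}$ for all $g\in G$ and all $i\in I$; every element of $\mathcal F$ is then a free group. Assume that some element of $\mathcal F$ has rank at least two. For a free group $H$ write $\bar r(H)=\max\{\operatorname{rank}(H)-1,0\}\in\mathbb N\cup\{\infty\}$, where $\operatorname{rank}(H)\in\mathbb N\cup\{\infty\}$ is the least cardinality of a generating set of $H$, and put $$\sigma(\mathcal F)=\sup\left\{\frac{\bar r(H\cap K)}{\bar r(H)\,\bar r(K)} : H,K\in\mathcal F,\ \bar r(H)\,\bar r(K)\neq 0\right\}\in[1,\infty].$$ Let $\alpha(G)=\inf\{|L| : L\le G,\ |L|\ge 3\}\in[3,\infty]$ (with $\inf\emptyset=\infty$), let $\psi(G)=\frac{\alpha(G)}{\alpha(G)-2}$, which is read as $1$ if $\alpha(G)=\infty$, and let $\beta(G)=2$ if $G$ has a subgroup of order two and $\beta(G)=1$ otherwise. Then $$\sigma(\mathcal F)\ \ge\ \beta(G)\cdot\psi(G).$$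 -/

import Mathlib

open scoped ENNReal

noncomputable section

namespace KuroshFree

/-- The rank of a group: the least cardinality of a generating set, in `ℕ ∪ {∞}`. -/
def rank (G : Type*) [Group G] : ℕ∞ :=
  sInf {n : ℕ∞ | ∃ S : Set G, Subgroup.closure S = ⊤ ∧ S.encard = n}

/-- The reduced rank `max (rank G - 1) 0`; subtraction on `ℕ∞` is truncated and `∞ - 1 = ∞`.
It is only meaningful for free groups. -/
def reducedRank (G : Type*) [Group G] : ℕ∞ :=
  rank G - 1

/-- The infimum of the orders of the subgroups of `G` having at least three elements;
it is `∞` if there is no finite such subgroup. -/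
def height (G : Type*) [Group G] : ℕ∞ :=
  sInf {n : ℕ∞ | ∃ L : Subgroup G, 3 ≤ ENat.card L ∧ ENat.card L = n}

open Classical in
/-- The function `x ↦ x / (x - 2)` from `[3, ∞]` to `[1, 3]`, with value `1` at `∞`. -/
def psi (x : ℝ≥0∞) : ℝ≥0∞ :=
  if x = ⊤ then 1 else x / (x - 2)

/-- The value of `psi` at the height of `G`. -/
def psiHeight (G : Type*) [Group G] : ℝ≥0∞ :=
  psi (height G : ℝ≥0∞)

open Classical in
/-- `2` if `G` has a subgroup of order two, and `1` otherwise. -/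
def beta (G : Type*) [Group G] : ℝ≥0∞ :=
  if ∃ L : Subgroup G, Nat.card L = 2 then 2 else 1

/-- The supremum, in `[0, ∞]`, of `rr(H ∩ K) / (rr(H) rr(K))` over all members `H`, `K` of a set
of subgroups with `rr(H) rr(K) ≠ 0`. -/
def sigma {G : Type*} [Group G] (𝓕 : Set (Subgroup G)) : ℝ≥0∞ :=
  sSup {x : ℝ≥0∞ | ∃ H ∈ 𝓕, ∃ K ∈ 𝓕, reducedRank H * reducedRank K ≠ 0 ∧
    x = (reducedRank (H ⊓ K : Subgroup G) : ℝ≥0∞) /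
      ((reducedRank H : ℝ≥0∞) * (reducedRank K : ℝ≥0∞))}

section FreeProduct

variable (F : Type*) [Group F] {I : Type*} (A : I → Type*) [∀ i, Group (A i)]

/-- The free product of `F` and all the groups `A i`. -/
abbrev FreeProd : Type _ := Monoid.Coprod F (Monoid.CoprodI A)

/-- The canonical copy of the free factor `A i` in the free product. -/
def factor (i : I) : Subgroup (FreeProd F A) :=
  ((Monoid.Coprod.inr : Monoid.CoprodI A →* FreeProd F A).comp
    (Monoid.CoprodI.of : A i →* Monoid.CoprodI A)).range

/-- The finitely generated subgroups `H` of the free product that meet every conjugate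
`g⁻¹ (A i) g` of every factor `A i` trivially. -/
def family : Set (Subgroup (FreeProd F A)) :=
  {H | H.FG ∧ ∀ (g : FreeProd F A) (i : I),
    H ⊓ (factor F A i).map (MulAut.conj g⁻¹).toMonoidHom = ⊥}

end FreeProduct

end KuroshFree

end

/-! Finite subgroups `L t` of `G` are conjugated so that they generate their free product `P` inside
`G`, and so that an element of `P` conjugate into a factor of `G` is already conjugate into some `L
t` (`GoodPosition.isConj_of`). If `P` acts transitively on a finite set `X` and every `L t` acts
freely, point stabilizers then meet all conjugates of the factors trivially. Their reduced rank is
`|X| * e`, where `e = |T| - 1 - ∑ 1/|L t|` is minus the Euler characteristic of `P`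
(`FactorsActFreely.rank_stabilizer`).

Take two such actions, on `X` and `Y`, with `P` transitive on `X × Y`. The intersection of two
stabilizers is the stabilizer of a pair, so the ratio is `|X||Y|e / (|X|e · |Y|e) = 1/e`
(`GoodPosition.hasRatio`). Everything reduces to choosing the subgroups and the actions.

The height of `G`, if finite, is 4 or an odd prime. Two subgroups of odd prime order `p` give `1/e =
p/(p-2)`; orders 2 and `n`, with `n` the height, give `2n/(n-2)`; three subgroups of order 2 give 2.
With infinite height and no involution, the ratio 1 comes from `H = K` of rank two. The hypothesis
on rank excludes the degenerate cases: at most one nontrivial factor, and the infinite dihedral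
group. -/

namespace KuroshFree
open Monoid Monoid.CoprodI

/-! ### Syllable length and reduced words in a free product. -/

section WordLength

variable {J : Type*} {B : J → Type*} [∀ j, Group (B j)]

open Classical in
/-- The number of syllables of an element of a free product. -/
noncomputable def syllables (g : CoprodI B) : ℕ := (Word.equiv g).toList.length

theorem syllables_one : syllables (1 : CoprodI B) = 0 := by
  classical
  have : Word.equiv (1 : CoprodI B) = Word.empty := (Equiv.eq_symm_apply _).1 rfl
  simp [syllables, this]

theorem syllables_prod (w : Word B) : syllables w.prod = w.toList.length := by
  classical
  have : Word.equiv w.prod = w := Word.equiv.right_inv w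
  simp [syllables, this]

theorem exists_word (g : CoprodI B) : ∃ w : Word B, w.prod = g := by
  classical
  exact ⟨Word.equiv g, Word.equiv.left_inv g⟩

theorem syllables_of_mul_le {j : J} (b : B j) (g : CoprodI B) :
    syllables (of b * g) ≤ syllables g + 1 := by
  classical
  obtain ⟨w, rfl⟩ := exists_word g
  rw [← Word.prod_smul, syllables_prod, syllables_prod, Word.of_smul_def]
  have key : ∀ p : Word.Pair B j, p.tail.toList.length ≤ (Word.rcons p).toList.length ∧
      (Word.rcons p).toList.length ≤ p.tail.toList.length + 1 := by
    intro p
    by_cases h : p.head = 1 <;> simp [Word.rcons, h]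
  have h1 := (key (Word.equivPair j w)).1
  rw [← Word.equivPair_symm, Equiv.symm_apply_apply] at h1
  refine (key _).2.trans ?_
  simpa using h1

theorem syllables_list_prod_le (l : List (Σ j, B j)) :
    syllables (l.map fun x => (of x.2 : CoprodI B)).prod ≤ l.length := by
  induction l with
  | nil => simp [syllables_one]
  | cons a l ih =>
    rw [List.map_cons, List.prod_cons, List.length_cons]
    exact (syllables_of_mul_le _ _).trans (by omega)

theorem exists_list (g : CoprodI B) : ∃ l : List (Σ j, B j),
    (l.map fun x => (of x.2 : CoprodI B)).prod = g ∧ l.length = syllables g := by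
  obtain ⟨w, rfl⟩ := exists_word g
  exact ⟨w.toList, rfl, (syllables_prod w).symm⟩

theorem syllables_mul_le (g h : CoprodI B) : syllables (g * h) ≤ syllables g + syllables h := by
  obtain ⟨l, rfl, hl⟩ := exists_list g
  obtain ⟨k, rfl, hk⟩ := exists_list h
  rw [← hl, ← hk, ← List.prod_append, ← List.map_append, ← List.length_append]
  exact syllables_list_prod_le _

/-- `IsReduced i j n g`: the normal form of `g` begins with a letter from `B i`, ends with a
letter from `B j`, and has at least `n` letters. -/
def IsReduced (i j : J) (n : ℕ) (g : CoprodI B) : Prop :=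
  ∃ w : NeWord B i j, w.prod = g ∧ n ≤ w.toList.length

theorem IsReduced.le_syllables {i j : J} {n : ℕ} {g : CoprodI B} (h : IsReduced i j n g) :
    n ≤ syllables g := by
  obtain ⟨w, rfl, hn⟩ := h
  rw [NeWord.prod, syllables_prod]
  exact hn

theorem isReduced_of {j : J} {b : B j} (hb : b ≠ 1) : IsReduced j j 1 (of b) :=
  ⟨.singleton b hb, by simp, by simp⟩

theorem IsReduced.mul {i j k l : J} {m n : ℕ} {g h : CoprodI B} (hg : IsReduced i j m g)
    (hjk : j ≠ k) (hh : IsReduced k l n h) : IsReduced i l (m + n) (g * h) := by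
  obtain ⟨v, rfl, hv⟩ := hg
  obtain ⟨w, rfl, hw⟩ := hh
  exact ⟨.append v hjk w, by simp, by simp; omega⟩

theorem IsReduced.inv {i j : J} {n : ℕ} {g : CoprodI B} (hg : IsReduced i j n g) :
    IsReduced j i n g⁻¹ := by
  obtain ⟨v, rfl, hv⟩ := hg
  refine ⟨v.inv, v.inv_prod, hv.trans ?_⟩
  have : ∀ {a b : J} (u : NeWord B a b), u.inv.toList.length = u.toList.length := by
    intro a b u
    induction u with
    | singleton => simp [NeWord.inv]
    | append u h w hu hw => simp [NeWord.inv, hu, hw]; omega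
  exact (this v).ge

theorem IsReduced.mono {i j : J} {m n : ℕ} {g : CoprodI B} (hg : IsReduced i j n g)
    (h : m ≤ n) : IsReduced i j m g := by
  obtain ⟨v, rfl, hv⟩ := hg
  exact ⟨v, rfl, h.trans hv⟩

/-- Every element of a free product is conjugate to an element of a factor, or to a cyclically
reduced word. -/
theorem isConj_of_or_cyclicallyReduced [Nonempty J] (g : CoprodI B) :
    (∃ (j : J) (b : B j), IsConj g (of b)) ∨
      ∃ (i j : J) (w : NeWord B i j), i ≠ j ∧ IsConj g w.prod := by
  induction h : syllables g using Nat.strong_induction_on generalizing g with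
  | _ n ih =>
  obtain ⟨w, rfl⟩ := exists_word g
  by_cases hw : w = Word.empty
  · left
    exact ⟨Classical.arbitrary J, 1, by rw [hw, map_one]; exact IsConj.refl _⟩
  obtain ⟨i, j, v, rfl⟩ := NeWord.of_word w hw
  by_cases hij : i = j
  swap
  · exact Or.inr ⟨i, j, v, hij, IsConj.refl _⟩
  subst hij
  obtain ⟨x, l, hl⟩ := List.exists_cons_of_ne_nil v.toList_ne_nil
  have hx : x = ⟨i, v.head⟩ := by
    have := v.toList_head?
    rw [hl] at this
    simpa using this
  subst hx
  rcases List.eq_nil_or_concat l with rfl | ⟨l, y, rfl⟩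
  · refine Or.inl ⟨i, v.head, ?_⟩
    have : v.toWord.prod = of v.head := by
      change (v.toList.map _).prod = _
      rw [hl]; simp
    rw [this]
  have hy : y = ⟨i, v.last⟩ := by
    have := v.toList_getLast?
    rw [hl] at this
    simpa [List.getLast?_cons] using this
  subst hy
  -- The first and last letters lie in one factor; conjugating by the last letter merges them, which
  -- lowers the syllable count.
  set g' : CoprodI B := of (v.last * v.head) * (l.map fun x => of x.2).prod with hg'
  have hconj : IsConj v.toWord.prod g' := by
    rw [isConj_iff]
    refine ⟨of v.last, ?_⟩
    have : v.toWord.prod = of v.head * (l.map fun x => of x.2).prod * of v.last := by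
      change (v.toList.map _).prod = _
      rw [hl]; simp [mul_assoc]
    rw [this, hg', map_mul]
    group
  have hlt : syllables g' < n := by
    have h1 : syllables g' ≤ l.length + 1 :=
      (syllables_of_mul_le _ _).trans (Nat.add_le_add_right (syllables_list_prod_le _) _)
    rw [← h, syllables_prod]
    change _ < v.toList.length
    rw [hl]; simp; omega
  rcases ih _ hlt g' rfl with ⟨k, b, hb⟩ | ⟨k, l, u, hkl, hu⟩
  · exact Or.inl ⟨k, b, hconj.trans hb⟩
  · exact Or.inr ⟨k, l, u, hkl, hconj.trans hu⟩

/-- Powers of a conjugate `x⁻¹ * of b * x` have bounded syllable length, since `b ^ n` remains a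
single letter. The fixed multipliers `c` and `d` change the length only by a constant. -/
theorem not_isConj_of_of_pow_unbounded {g : CoprodI B} {c d : CoprodI B}
    (h : ∀ n : ℕ, n ≤ syllables (c * g ^ n * d)) {j : J} (b : B j) : ¬ IsConj g (of b) := by
  intro hc
  obtain ⟨x, hx⟩ := isConj_iff.1 hc
  have hg : g = x⁻¹ * of b * x := by rw [← hx]; group
  have hpow : ∀ n : ℕ, g ^ n = x⁻¹ * (of (b ^ n) * x) := by
    intro n
    have := conj_pow (a := x⁻¹) (b := of b) (i := n)
    rw [inv_inv] at this
    rw [hg, this, map_pow, mul_assoc]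
  have h1 := h (syllables c + (syllables x⁻¹ + (syllables x + 1)) + syllables d + 1)
  rw [hpow] at h1
  have h2 := syllables_mul_le (c * (x⁻¹ * (of (b ^ (syllables c + (syllables x⁻¹ +
    (syllables x + 1)) + syllables d + 1)) * x))) d
  have h3 := syllables_mul_le c (x⁻¹ * (of (b ^ (syllables c + (syllables x⁻¹ +
    (syllables x + 1)) + syllables d + 1)) * x))
  have h4 := syllables_mul_le x⁻¹ (of (b ^ (syllables c + (syllables x⁻¹ +
    (syllables x + 1)) + syllables d + 1)) * x)
  have h5 := syllables_of_mul_le (b ^ (syllables c + (syllables x⁻¹ +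
    (syllables x + 1)) + syllables d + 1)) x
  omega

end WordLength

/-! ### Subgroups of factors conjugated so as to generate their free product. -/

section GoodPosition

variable {J : Type*} {B : J → Type*} [∀ j, Group (B j)]
variable {T : Type*}

/-- The subgroups `L t` are conjugate into the factors `B (j t)`, by the elements `y t`, in such
a way that there is no cancellation between them. -/
structure GoodPosition (L : T → Subgroup (CoprodI B)) (y : T → CoprodI B) (j : T → J) :
    Prop where
  conj : ∀ t, ∀ m ∈ L t, ∃ b : B (j t), (y t)⁻¹ * m * y t = of b
  sep : ∀ s t, s ≠ t → ((y s)⁻¹ * y t = 1 ∧ j s ≠ j t) ∨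
    ∃ i k, IsReduced i k 1 ((y s)⁻¹ * y t) ∧ j s ≠ i ∧ k ≠ j t

variable {L : T → Subgroup (CoprodI B)} {y : T → CoprodI B} {j : T → J}

/-- The homomorphism from the abstract free product of subgroups. -/
noncomputable abbrev toGroup (L : T → Subgroup (CoprodI B)) :
    CoprodI (fun t => L t) →* CoprodI B :=
  CoprodI.lift fun t => (L t).subtype

/-- The connecting word is either trivial between letters of distinct factors, or reduced with both
end letters outside the adjacent factors; in neither case does anything cancel. -/
theorem GoodPosition.join (h : GoodPosition L y j) {s t : T} (hst : s ≠ t) {a b : J} {m n : ℕ}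
    {g k : CoprodI B} (hg : IsReduced a (j s) m g) (hk : IsReduced (j t) b n k) :
    IsReduced a b (m + n) (g * ((y s)⁻¹ * y t) * k) := by
  rcases h.sep s t hst with ⟨h1, h2⟩ | ⟨i, l, h1, h2, h3⟩
  · rw [h1, mul_one]
    exact hg.mul h2 hk
  · exact ((hg.mul h2 h1).mul h3 hk).mono (by omega)

theorem GoodPosition.isReduced_toGroup (h : GoodPosition L y j) {s t : T}
    (w : NeWord (fun t => L t) s t) :
    IsReduced (j s) (j t) 1 ((y s)⁻¹ * toGroup L w.prod * y t) := by
  induction w with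
  | @singleton i x hx =>
    obtain ⟨b, hb⟩ := h.conj i x x.2
    rw [NeWord.prod_singleton, CoprodI.lift_of, Subgroup.subtype_apply, hb]
    refine isReduced_of ?_
    rintro rfl
    refine hx (Subtype.ext ?_)
    rw [map_one, mul_eq_one_iff_eq_inv, inv_mul_eq_iff_eq_mul, mul_inv_cancel] at hb
    exact hb
  | @append a b c d u hne v hu hv =>
    have := (h.join hne hu hv).mono (show 1 ≤ 1 + 1 by omega)
    convert this using 1
    rw [NeWord.append_prod, map_mul]
    group

/-- Since `s ≠ t`, consecutive copies of `w` concatenate without cancellation, and each contributes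
at least one letter. -/
theorem GoodPosition.isReduced_pow (h : GoodPosition L y j) {s t : T}
    (w : NeWord (fun t => L t) s t) (hst : s ≠ t) (n : ℕ) :
    IsReduced (j s) (j t) (n + 1) ((y s)⁻¹ * toGroup L w.prod ^ (n + 1) * y t) := by
  induction n with
  | zero => simpa using h.isReduced_toGroup w
  | succ n ih =>
    have := h.join hst.symm ih (h.isReduced_toGroup w)
    convert this using 1
    rw [pow_succ _ (n + 1)]
    group

/-- An element of the abstract free product whose image is conjugate into a factor is conjugate
into one of the free factors. -/
theorem GoodPosition.isConj_of (h : GoodPosition L y j) [Nonempty T]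
    (g : CoprodI fun t => L t) {i : J} (b : B i) (hg : IsConj (toGroup L g) (of b)) :
    ∃ (t : T) (m : L t), IsConj g (of m) := by
  rcases isConj_of_or_cyclicallyReduced g with h1 | ⟨s, t, w, hst, hw⟩
  · exact h1
  · exfalso
    have h2 : IsConj (toGroup L w.prod) (of b) := ((toGroup L).map_isConj hw).symm.trans hg
    refine not_isConj_of_of_pow_unbounded (c := (y s)⁻¹) (d := y t) ?_ b h2
    intro n
    cases n with
    | zero => exact Nat.zero_le _
    | succ n => exact (h.isReduced_pow w hst n).le_syllables

/-- The identity lies in a factor, so a kernel element is conjugate into some `L t`, on which the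
map is the inclusion. -/
theorem GoodPosition.toGroup_injective (h : GoodPosition L y j) [Nonempty T] :
    Function.Injective (toGroup L) := by
  rw [injective_iff_map_eq_one]
  intro g hg
  obtain ⟨t, m, hm⟩ := h.isConj_of g (1 : B (j (Classical.arbitrary T)))
    (by rw [hg, map_one])
  have h1 := (toGroup L).map_isConj hm
  rw [hg, CoprodI.lift_of, isConj_one_right, Subgroup.subtype_apply] at h1
  have h2 : m = 1 := Subtype.ext h1
  rw [h2, map_one, isConj_comm, isConj_one_right] at hm
  exact hm

end GoodPosition

/-! ### Torsion elements and centralizers in free products. -/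

section Torsion

variable {J : Type*} {B : J → Type*} [∀ j, Group (B j)]

/-- A cyclically reduced word has powers of unbounded length, hence infinite order. -/
theorem isConj_of_of_isOfFinOrder [Nonempty J] {g : CoprodI B} (hg : IsOfFinOrder g) :
    ∃ (j : J) (b : B j), IsConj g (of b) := by
  rcases isConj_of_or_cyclicallyReduced g with h1 | ⟨s, t, w, hst, hw⟩
  · exact h1
  · exfalso
    have hw' : IsOfFinOrder w.prod := by
      obtain ⟨c, hc⟩ := isConj_iff.1 hw
      rw [← hc]
      exact (MulAut.conj c).toMonoidHom.isOfFinOrder hg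
    obtain ⟨n, hn, hn1⟩ := isOfFinOrder_iff_pow_eq_one.1 hw'
    have : ∀ n : ℕ, IsReduced s t (n + 1) (w.prod ^ (n + 1)) := by
      intro n
      induction n with
      | zero => exact ⟨w, by simp, List.length_pos_iff.2 w.toList_ne_nil⟩
      | succ n ih =>
        rw [pow_succ]
        exact ih.mul hst.symm ⟨w, rfl, List.length_pos_iff.2 w.toList_ne_nil⟩
    obtain ⟨n, rfl⟩ : ∃ m, n = m + 1 := ⟨n - 1, by omega⟩
    have h1 := (this n).le_syllables
    rw [hn1, syllables_one] at h1
    omega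

/-- The elements commuting with a nontrivial element of a factor lie in that factor. -/
theorem mem_range_of_commute {j : J} {b : B j} (hb : b ≠ 1) {g : CoprodI B}
    (hg : Commute g (of b)) : ∃ c : B j, g = of c := by
  classical
  obtain ⟨w, hw⟩ := exists_word g⁻¹
  set p := Word.equivPair j w
  have hp : g⁻¹ = of p.head * p.tail.prod := by
    rw [← hw, ← Word.prod_rcons, ← Word.equivPair_symm, Equiv.symm_apply_apply]
  rcases eq_or_ne p.tail Word.empty with h | h
  · refine ⟨p.head⁻¹, ?_⟩
    rw [h, Word.prod_empty, mul_one] at hp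
    rw [map_inv, ← hp, inv_inv]
  exfalso
  obtain ⟨k, l, v, hv⟩ := NeWord.of_word _ h
  have hk : k ≠ j := by
    rintro rfl
    apply p.fstIdx_ne
    rw [← hv]
    simp [Word.fstIdx, NeWord.toWord]
  have hvp : v.prod = p.tail.prod := by rw [NeWord.prod, hv]
  have hred : IsReduced k l 1 v.prod := ⟨v, rfl, List.length_pos_iff.2 v.toList_ne_nil⟩
  have hc : p.head⁻¹ * b * p.head ≠ 1 := by
    intro h1
    apply hb
    rw [mul_eq_one_iff_eq_inv, inv_mul_eq_iff_eq_mul, mul_inv_cancel] at h1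
    exact h1
  -- A nonempty tail would make the conjugate of `of b` by `g` a reduced word of at least three
  -- letters, although it equals the single letter `of b`.
  have h3 := ((hred.inv.mul hk (isReduced_of hc)).mul hk.symm hred).le_syllables
  have h4 : v.prod⁻¹ * of (p.head⁻¹ * b * p.head) * v.prod = of b := by
    have h5 : v.prod = of p.head⁻¹ * g⁻¹ := by rw [hp, hvp, map_inv]; group
    have h6 : g * of b * g⁻¹ = of b := by rw [hg.eq]; group
    calc _ = g * of b * g⁻¹ := by rw [h5]; simp only [map_mul, map_inv]; group
      _ = _ := h6
  rw [h4] at h3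
  have h7 := syllables_of_mul_le b 1
  rw [mul_one, syllables_one] at h7
  omega

end Torsion

/-! ### Trivializing edge labels along a spanning tree. -/

section Gauge

/-- In a connected finite graph whose edges carry labels in a group, the labels along a spanning
tree can be made trivial by a change of gauge. -/
theorem exists_gauge {V E N : Type*} [Fintype V] [Group N] (a b : E → V) (lab : E → N) (v₀ : V)
    (hconn : ∀ S : Finset V, v₀ ∈ S → S ≠ Finset.univ →
      ∃ e, (a e ∈ S ∧ b e ∉ S) ∨ (a e ∉ S ∧ b e ∈ S)) :
    ∃ n : V → N, n v₀ = 1 ∧ ∃ D : Finset E, D.card + 1 = Fintype.card V ∧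
      ∀ e ∈ D, (n (a e))⁻¹ * lab e * n (b e) = 1 := by
  classical
  -- The tree grows by one vertex at a time: `k` edges span `k + 1` vertices, and the gauge at the
  -- new vertex is chosen to kill the label of the edge that attaches it.
  suffices h : ∀ k, k + 1 ≤ Fintype.card V → ∃ n : V → N, n v₀ = 1 ∧ ∃ S : Finset V, v₀ ∈ S ∧
      S.card = k + 1 ∧ ∃ D : Finset E, D.card = k ∧
      ∀ e ∈ D, a e ∈ S ∧ b e ∈ S ∧ (n (a e))⁻¹ * lab e * n (b e) = 1 by
    have hpos : 0 < Fintype.card V := Fintype.card_pos_iff.2 ⟨v₀⟩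
    obtain ⟨n, hn, S, -, -, D, hD, hD'⟩ := h (Fintype.card V - 1) (by omega)
    exact ⟨n, hn, D, by omega, fun e he => (hD' e he).2.2⟩
  intro k
  induction k with
  | zero => exact fun _ => ⟨fun _ => 1, rfl, {v₀}, by simp, by simp, ∅, by simp, by simp⟩
  | succ k ih =>
    intro hk
    obtain ⟨n, hn, S, hS, hSk, D, hD, hD'⟩ := ih (by omega)
    have hSu : S ≠ Finset.univ := by
      rintro rfl
      rw [Finset.card_univ] at hSk
      omega
    obtain ⟨e, he⟩ := hconn S hS hSu
    have heD : e ∉ D := fun h => by have := hD' e h; tauto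
    obtain ⟨w, u, hw, hn', hwe⟩ : ∃ (w : V) (u : N), w ∉ S ∧
        (Function.update n w u (a e))⁻¹ * lab e * Function.update n w u (b e) = 1 ∧
        (a e ∈ insert w S ∧ b e ∈ insert w S) := by
      rcases he with ⟨ha, hb⟩ | ⟨ha, hb⟩
      · have hab : a e ≠ b e := fun h => hb (h ▸ ha)
        exact ⟨b e, (lab e)⁻¹ * n (a e), hb, by simp [hab], by simp [ha]⟩
      · have hab : b e ≠ a e := fun h => ha (h ▸ hb)
        exact ⟨a e, lab e * n (b e), ha, by simp [hab], by simp [hb]⟩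
    have hne : ∀ v ∈ S, v ≠ w := fun v hv h => hw (h ▸ hv)
    refine ⟨Function.update n w u, ?_, insert w S, by simp [hS], by simp [hw, hSk],
      insert e D, by simp [heD, hD], ?_⟩
    · rw [Function.update_of_ne (hne _ hS), hn]
    · intro f hf
      rcases Finset.mem_insert.1 hf with rfl | hf
      · exact ⟨hwe.1, hwe.2, hn'⟩
      · obtain ⟨h1, h2, h3⟩ := hD' f hf
        refine ⟨Finset.mem_insert_of_mem h1, Finset.mem_insert_of_mem h2, ?_⟩
        rw [Function.update_of_ne (hne _ h1), Function.update_of_ne (hne _ h2), h3]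

end Gauge

/-! ### Generators of a point stabilizer, by a Reidemeister–Schreier argument. -/

section UpperBound

variable {P : Type*} [Group P] {T : Type*} (R : T → Subgroup P) {X : Type*} [MulAction P X]

/-- The orbits of the subgroups `R t` on `X`. -/
abbrev Orbits (X : Type*) [MulAction P X] : Type _ :=
  Σ t, MulAction.orbitRel.Quotient (R t) X

/-- The orbit of a point under one of the subgroups. -/
abbrev orbitOf (t : T) (x : X) : Orbits R X := ⟨t, Quotient.mk _ x⟩

theorem orbitOf_smul (t : T) {r : P} (hr : r ∈ R t) (x : X) :
    orbitOf R t (r • x) = orbitOf R t x := by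
  unfold orbitOf
  congr 1
  apply Quotient.sound
  exact ⟨⟨r, hr⟩, rfl⟩

/-- A subgroup acting freely admits an equivariant section of any orbit map. -/
theorem exists_equivariant_section (x₀ : X) (s : X → P) (hs : ∀ x, s x • x₀ = x)
    (Q : Subgroup P) (hfree : ∀ r ∈ Q, ∀ x : X, r • x = x → r = 1) :
    ∃ q : X → P, (∀ x, q x • x₀ = x) ∧ ∀ r ∈ Q, ∀ x, q (r • x) = r * q x := by
  classical
  have hout : ∀ x : X, ∃ r ∈ Q,
      r • (Quotient.mk (MulAction.orbitRel Q X) x).out = x := by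
    intro x
    have h : (MulAction.orbitRel Q X) x (Quotient.mk (MulAction.orbitRel Q X) x).out :=
      Setoid.symm' _ (Quotient.mk_out (s := MulAction.orbitRel Q X) x)
    obtain ⟨r, hr⟩ := h
    exact ⟨r, r.2, hr⟩
  choose ρ hρQ hρ using hout
  refine ⟨fun x => ρ x * s (Quotient.mk (MulAction.orbitRel Q X) x).out, ?_, ?_⟩
  · intro x
    rw [mul_smul, hs, hρ]
  · intro r hr x
    have h1 : (Quotient.mk (MulAction.orbitRel Q X) (r • x)) =
        Quotient.mk (MulAction.orbitRel Q X) x := Quotient.sound ⟨⟨r, hr⟩, rfl⟩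
    have h2 : ρ (r • x) = r * ρ x := by
      -- Freeness makes the element carrying the orbit representative to a given point unique, hence
      -- equivariant.
      have h3 := hρ (r • x)
      rw [h1] at h3
      have h4 := hfree ((r * ρ x)⁻¹ * ρ (r • x))
        (Q.mul_mem (Q.inv_mem (Q.mul_mem hr (hρQ x))) (hρQ _))
        (Quotient.mk (MulAction.orbitRel Q X) x).out (by
          rw [mul_smul, h3, inv_smul_eq_iff, mul_smul, hρ])
      exact (inv_mul_eq_one.1 h4).symm
    simp only [h1, h2, mul_assoc]

variable [Fintype T] [Fintype X]

noncomputable instance : Fintype (Orbits R X) := by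
  classical
  exact Fintype.ofFinite _

variable {R}

/-- Connectedness of the quotient graph. -/
theorem exists_crossing_edge [MulAction.IsPretransitive P X] (hR : ⨆ t, R t = ⊤) [Nonempty T]
    (x₀ : X) (S : Finset (X ⊕ Orbits R X)) (hx₀ : Sum.inl x₀ ∈ S) (hS : S ≠ Finset.univ) :
    ∃ e : T × X, (Sum.inl e.2 ∈ S ∧ Sum.inr (orbitOf R e.1 e.2) ∉ S) ∨
      (Sum.inl e.2 ∉ S ∧ Sum.inr (orbitOf R e.1 e.2) ∈ S) := by
  -- The bipartite graph has vertices `X ⊕ Orbits R X`, and the edge `(t, x)` joins `x` to its `R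
  -- t`-orbit. A vertex set that no edge leaves is invariant under every `R t`, hence under `P`, and
  -- transitivity makes it everything.
  by_contra! h
  have h1 : ∀ t x, Sum.inl x ∈ S ↔ Sum.inr (orbitOf R t x) ∈ S := fun t x =>
    ⟨(h (t, x)).1, fun h2 => by_contra fun h3 => (h (t, x)).2 h3 h2⟩
  have h2 : ∀ g ∈ ⨆ t, R t, ∀ x : X, Sum.inl x ∈ S → Sum.inl (g • x) ∈ S := by
    intro g hg
    induction hg using Subgroup.iSup_induction' with
    | hp t r hr =>
      intro x hx
      rw [h1 t, orbitOf_smul R t hr, ← h1 t]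
      exact hx
    | h1 => simp
    | hmul g k _ _ ihg ihk =>
      intro x hx
      rw [mul_smul]
      exact ihg _ (ihk _ hx)
  have h3 : ∀ x : X, Sum.inl x ∈ S := by
    intro x
    obtain ⟨g, rfl⟩ := MulAction.exists_smul_eq P x₀ x
    exact h2 g (hR ▸ Subgroup.mem_top g) x₀ hx₀
  apply hS
  ext v
  simp only [Finset.mem_univ, iff_true]
  rcases v with x | ⟨t, o⟩
  · exact h3 x
  · induction o using Quotient.inductionOn with
    | h x => exact (h1 t x).1 (h3 x)

/-- The stabilizer of a point is generated by as many elements as there are edges outside a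
spanning tree of the quotient graph. -/
theorem exists_generators_stabilizer [MulAction.IsPretransitive P X] (hR : ⨆ t, R t = ⊤)
    [Nonempty T] (hfree : ∀ t, ∀ r ∈ R t, ∀ x : X, r • x = x → r = 1) (x₀ : X) :
    ∃ S : Finset P, Subgroup.closure (S : Set P) = MulAction.stabilizer P x₀ ∧
      S.card + Fintype.card X + Fintype.card (Orbits R X) ≤
        Fintype.card T * Fintype.card X + 1 := by
  classical
  have hsec : ∀ x : X, ∃ g : P, g • x₀ = x ∧ (x = x₀ → g = 1) := by
    intro x
    by_cases hx : x = x₀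
    · exact ⟨1, by simp [hx], fun _ => rfl⟩
    · obtain ⟨g, hg⟩ := MulAction.exists_smul_eq P x₀ x
      exact ⟨g, hg, fun h => absurd h hx⟩
  choose s hs hs1 using hsec
  choose q hq hqe using fun t => exists_equivariant_section x₀ s hs (R t) (hfree t)
  let N := MulAction.stabilizer P x₀
  have hlab : ∀ e : T × X, (s e.2)⁻¹ * q e.1 e.2 ∈ N := fun e => by
    rw [MulAction.mem_stabilizer_iff, mul_smul, hq, inv_smul_eq_iff, hs]
  -- The edge `(t, x)` is labelled by the discrepancy between the global section `s` and the `R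
  -- t`-equivariant section `q t`. The gauge kills `|X| + |Orbits| - 1` of the `|T||X|` labels; the
  -- others generate the stabilizer.
  obtain ⟨n, hn, D, hD, hD'⟩ := exists_gauge (V := X ⊕ Orbits R X) (E := T × X) (N := N)
    (fun e => Sum.inl e.2) (fun e => Sum.inr (orbitOf R e.1 e.2)) (fun e => ⟨_, hlab e⟩)
    (Sum.inl x₀) (exists_crossing_edge hR x₀)
  let s' : X → P := fun x => s x * n (Sum.inl x)
  let q' : T → X → P := fun t x => q t x * n (Sum.inr (orbitOf R t x))
  let lab' : T × X → P := fun e => (s' e.2)⁻¹ * q' e.1 e.2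
  have hs' : ∀ x, s' x • x₀ = x := fun x => by
    simp only [s']
    rw [mul_smul, (n (Sum.inl x)).2, hs]
  have hq' : ∀ t x, q' t x • x₀ = x := fun t x => by
    simp only [q']
    rw [mul_smul, (n _).2, hq]
  have hqe' : ∀ t, ∀ r ∈ R t, ∀ x, q' t (r • x) = r * q' t x := fun t r hr x => by
    simp only [q']
    rw [orbitOf_smul R t hr, hqe t r hr, mul_assoc]
  have hlab1 : ∀ e ∈ D, lab' e = 1 := by
    intro e he
    have := congrArg Subtype.val (hD' e he)
    simp only [Subgroup.coe_mul, InvMemClass.coe_inv, Subgroup.coe_one] at this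
    simp only [lab', s', q']
    rw [← this]
    group
  have hs0 : s' x₀ = 1 := by simp [s', hn, hs1 x₀ rfl]
  refine ⟨(Finset.univ \ D).image lab', ?_, ?_⟩
  · set N' := Subgroup.closure (((Finset.univ \ D).image lab' : Finset P) : Set P) with hN'
    have hmem : ∀ e, lab' e ∈ N' := by
      intro e
      by_cases he : e ∈ D
      · rw [hlab1 e he]; exact N'.one_mem
      · exact Subgroup.subset_closure (Finset.mem_coe.2 (Finset.mem_image_of_mem _ (by simp [he])))
    apply le_antisymm
    · rw [hN', Subgroup.closure_le]
      intro g hg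
      obtain ⟨e, -, rfl⟩ := Finset.mem_image.1 (Finset.mem_coe.1 hg)
      change _ • _ = _
      rw [mul_smul, hq', inv_smul_eq_iff, hs']
    · have key : ∀ g ∈ ⨆ t, R t, ∀ h : P, (s' (h • x₀))⁻¹ * h ∈ N' →
          (s' ((g * h) • x₀))⁻¹ * (g * h) ∈ N' := by
        intro g hg
        induction hg using Subgroup.iSup_induction' with
        | hp t r hr =>
          intro h hh
          -- By equivariance of `q'`, left multiplication by `r ∈ R t` changes the Schreier element
          -- of `h` by one label times the inverse of another.
          have h1 := N'.mul_mem (N'.mul_mem (hmem (t, r • h • x₀)) (N'.inv_mem (hmem (t, h • x₀)))) hh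
          convert h1 using 1
          simp only [lab', hqe' t r hr, mul_smul]
          group
        | h1 => simp
        | hmul g k _ _ ihg ihk =>
          intro h hh
          have := ihg _ (ihk h hh)
          rwa [← mul_assoc g k h] at this
      intro g hg
      have h1 := key g (hR ▸ Subgroup.mem_top g) 1 (by simp [hs0])
      rw [mul_one, MulAction.mem_stabilizer_iff.1 hg, hs0, inv_one, one_mul] at h1
      exact h1
  · have h1 : ((Finset.univ \ D).image lab').card ≤ Fintype.card T * Fintype.card X - D.card := by
      refine Finset.card_image_le.trans ?_
      rw [Finset.card_sdiff_of_subset (Finset.subset_univ D), Finset.card_univ, Fintype.card_prod]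
    have h2 : D.card ≤ Fintype.card T * Fintype.card X := by
      rw [← Fintype.card_prod]; exact Finset.card_le_univ D
    rw [Fintype.card_sum] at hD
    omega

end UpperBound

/-! ### No generating set is smaller: a cocycle and a dimension count. -/

section LowerBound

variable {T : Type*} [DecidableEq T] {M : T → Type*} [∀ t, Group (M t)]
  {X : Type*} [DecidableEq X] [MulAction (CoprodI M) X]

/-- The universal cocycle on a set with an action of a free product. -/
theorem exists_cocycle : ∃ c : CoprodI M → X → (T × X → ℚ),
    (∀ g h x, c (g * h) x = c h x + c g (h • x)) ∧
    ∀ t (m : M t) x, c (of m) x = Pi.single (t, x) 1 - Pi.single (t, (of m : CoprodI M) • x) 1 := by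
  let A := T × X → ℚ
  let h : CoprodI M →* Equiv.Perm (X × A) :=
    { toFun := fun g => Equiv.prodCongr (MulAction.toPerm g) (Equiv.refl A)
      map_one' := by ext x <;> simp
      map_mul' := fun g k => by ext x <;> simp [mul_smul] }
  let σ : T → Equiv.Perm (X × A) := fun t =>
    { toFun := fun p => (p.1, p.2 + Pi.single (t, p.1) 1)
      invFun := fun p => (p.1, p.2 - Pi.single (t, p.1) 1)
      left_inv := fun p => by simp
      right_inv := fun p => by simp }
  -- On each factor the cocycle is a coboundary, so the factor `t` acts by the product action
  -- conjugated by the shift `σ t`; the universal property of the free product assembles these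
  -- actions.
  let Θ : CoprodI M →* Equiv.Perm (X × A) := CoprodI.lift fun t =>
    (MulAut.conj (σ t)⁻¹).toMonoidHom.comp (h.comp of)
  have hof : ∀ t (m : M t) (x : X) (z : A), Θ (of m) (x, z) = ((of m : CoprodI M) • x,
      z + (Pi.single (t, x) 1 - Pi.single (t, (of m : CoprodI M) • x) 1)) := by
    intro t m x z
    simp only [Θ, CoprodI.lift_of]
    change ((of m : CoprodI M) • x, z + Pi.single (t, x) 1 -
      Pi.single (t, (of m : CoprodI M) • x) 1) = _
    rw [add_sub_assoc]
  have hΘ : ∀ (g : CoprodI M) (x : X) (z : A), Θ g (x, z) = (g • x, z + (Θ g (x, 0)).2) := by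
    intro g
    induction g using CoprodI.induction_on with
    | one => intro x z; simp
    | of t m => intro x z; rw [hof, hof, zero_add]
    | mul g k hg hk =>
      intro x z
      rw [map_mul, Equiv.Perm.mul_apply, Equiv.Perm.mul_apply, hk x z, hk x 0, hg, hg _ (0 + _)]
      rw [mul_smul]
      simp [add_assoc]
  refine ⟨fun g x => (Θ g (x, 0)).2, ?_, ?_⟩
  · intro g k x
    simp only [map_mul, Equiv.Perm.mul_apply]
    rw [hΘ k x 0, hΘ g _ (0 + _)]
  · intro t m x
    simp only [hof, zero_add]

variable (M) in
/-- The copies of the factors in the free product. -/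
abbrev factorRange (t : T) : Subgroup (CoprodI M) := (of : M t →* CoprodI M).range

/-- On the stabilizer the cocycle at `x₀` is additive, so its values span a space `W` of dimension
at most `|S|`. Functionals vanishing on `W` are differences of functions on the two kinds of
vertices, normalized at `x₀`, so they form a space of dimension at most `|X| - 1 + |Orbits|`. The
two dimensions add up to `|T||X|`. -/
theorem le_card_generators_stabilizer [Fintype T] [Fintype X]
    [MulAction.IsPretransitive (CoprodI M) X] (x₀ : X)
    (S : Finset (CoprodI M))
    (hS : Subgroup.closure (S : Set (CoprodI M)) = MulAction.stabilizer (CoprodI M) x₀) :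
    Fintype.card T * Fintype.card X + 1 ≤
      S.card + Fintype.card X + Fintype.card (Orbits (factorRange M) X) := by
  obtain ⟨c, hc, hcof⟩ := exists_cocycle (M := M) (X := X)
  have hc1 : ∀ x, c 1 x = 0 := fun x => by
    have := hc 1 1 x
    simpa using this
  let W : Submodule ℚ (T × X → ℚ) := Submodule.span ℚ ((S.image fun g => c g x₀ : Finset _) : Set _)
  have hW : ∀ g ∈ MulAction.stabilizer (CoprodI M) x₀, c g x₀ ∈ W := by
    intro g hg
    rw [← hS] at hg
    have hst : ∀ g ∈ Subgroup.closure (S : Set (CoprodI M)), g • x₀ = x₀ := fun g hg => by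
      rw [hS] at hg; exact hg
    induction hg using Subgroup.closure_induction with
    | mem g hg =>
      exact Submodule.subset_span (Finset.mem_coe.2 (Finset.mem_image_of_mem _ hg))
    | one => rw [hc1]; exact W.zero_mem
    | mul g k _ hk ihg ihk =>
      rw [hc, hst k hk]
      exact W.add_mem ihk ihg
    | inv g hg ih =>
      have h1 := hc g⁻¹ g x₀
      rw [inv_mul_cancel, hc1, hst g hg] at h1
      rw [← neg_eq_of_add_eq_zero_right h1.symm]
      exact W.neg_mem ih
  have hWcard : Module.finrank ℚ W ≤ S.card :=
    (finrank_span_finset_le_card _).trans Finset.card_image_le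
  let Y := ({x : X // x ≠ x₀} → ℚ) × (Orbits (factorRange M) X → ℚ)
  let Ψ : Y →ₗ[ℚ] (T × X → ℚ) :=
    { toFun := fun p e => p.2 (orbitOf (factorRange M) e.1 e.2) -
        (if h : e.2 = x₀ then 0 else p.1 ⟨e.2, h⟩)
      map_add' := fun p p' => by
        ext e
        change (p.2 _ + p'.2 _) - (if h : e.2 = x₀ then 0 else p.1 ⟨e.2, h⟩ + p'.1 ⟨e.2, h⟩) =
          (p.2 _ - if h : e.2 = x₀ then 0 else p.1 ⟨e.2, h⟩) +
            (p'.2 _ - if h : e.2 = x₀ then 0 else p'.1 ⟨e.2, h⟩)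
        split_ifs <;> ring
      map_smul' := fun r p => by
        ext e
        change r * p.2 _ - (if h : e.2 = x₀ then 0 else r * p.1 ⟨e.2, h⟩) =
          r * (p.2 _ - if h : e.2 = x₀ then 0 else p.1 ⟨e.2, h⟩)
        split_ifs <;> ring }
  let res : Module.Dual ℚ (T × X → ℚ) →ₗ[ℚ] (T × X → ℚ) :=
    { toFun := fun f e => f (Pi.single e 1)
      map_add' := fun f g => rfl
      map_smul' := fun r f => rfl }
  have hres : Function.Injective res := by
    intro f g hfg
    apply LinearMap.pi_ext'
    intro e
    ext
    exact congrFun hfg e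
  have hann : W.dualAnnihilator.map res ≤ LinearMap.range Ψ := by
    rintro _ ⟨f, hf, rfl⟩
    have hfW : ∀ g ∈ MulAction.stabilizer (CoprodI M) x₀, f (c g x₀) = 0 := fun g hg =>
      (Submodule.mem_dualAnnihilator f).1 hf _ (hW g hg)
    have hex : ∀ x : X, ∃ g : CoprodI M, g • x₀ = x := MulAction.exists_smul_eq _ x₀
    choose s hs using hex
    -- As `f` vanishes on `W`, the value `f (c g x₀)` depends only on `g • x₀`; it is the potential
    -- on the points of `X`. The sum `f (Pi.single (t, x) 1) + u x` is then constant on the orbits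
    -- of the factor `t`, which gives the potential `v` on the orbits.
    let u : X → ℚ := fun x => f (c (s x) x₀)
    have hu : ∀ g : CoprodI M, u (g • x₀) = f (c g x₀) := by
      intro g
      have hst : (s (g • x₀))⁻¹ * g ∈ MulAction.stabilizer (CoprodI M) x₀ := by
        rw [MulAction.mem_stabilizer_iff, mul_smul, inv_smul_eq_iff, hs]
      have h1 : c g x₀ = c ((s (g • x₀))⁻¹ * g) x₀ + c (s (g • x₀)) x₀ := by
        conv_lhs => rw [← mul_inv_cancel_left (s (g • x₀)) g]
        rw [hc, MulAction.mem_stabilizer_iff.1 hst]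
      rw [h1, map_add, hfW _ hst, zero_add]
    have hu0 : u x₀ = 0 := by
      have := hu 1
      rwa [one_smul, hc1, map_zero] at this
    have hinv : ∀ t (m : M t) x, f (Pi.single (t, (of m : CoprodI M) • x) 1) +
        u ((of m : CoprodI M) • x) = f (Pi.single (t, x) 1) + u x := by
      intro t m x
      obtain ⟨g, rfl⟩ := MulAction.exists_smul_eq (CoprodI M) x₀ x
      rw [← mul_smul, hu, hu, hc, hcof, map_add, map_sub, mul_smul]
      ring
    let v : Orbits (factorRange M) X → ℚ := fun o =>
      Quotient.lift (fun x => f (Pi.single (o.1, x) 1) + u x) (by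
        rintro x y ⟨⟨_, m, rfl⟩, h⟩
        rw [← h]
        exact hinv o.1 m y) o.2
    refine ⟨(fun x => u x.1, v), ?_⟩
    ext e
    change (f (Pi.single (e.1, e.2) 1) + u e.2) - (if h : e.2 = x₀ then 0 else u e.2) =
      f (Pi.single e 1)
    split_ifs with h
    · rw [h, hu0]; simp [← h]
    · simp
  have h1 := Subspace.finrank_add_finrank_dualAnnihilator_eq W
  have h2 : Module.finrank ℚ W.dualAnnihilator ≤ Module.finrank ℚ Y := by
    rw [(Submodule.equivMapOfInjective res hres _).finrank_eq]
    exact (Submodule.finrank_mono hann).trans (LinearMap.finrank_range_le Ψ)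
  have h3 : Module.finrank ℚ Y = Fintype.card {x : X // x ≠ x₀} +
      Fintype.card (Orbits (factorRange M) X) := by
    simp only [Y, Module.finrank_prod, Module.finrank_fintype_fun_eq_card]
  have h4 : Fintype.card {x : X // x ≠ x₀} = Fintype.card X - 1 := by
    simp
  have h5 : 0 < Fintype.card X := Fintype.card_pos_iff.2 ⟨x₀⟩
  rw [Module.finrank_fintype_fun_eq_card, Fintype.card_prod] at h1
  omega

end LowerBound

/-! ### Elementary properties of the rank. -/

section Rank

theorem rank_le_of_mulEquiv {G G' : Type*} [Group G] [Group G'] (e : G ≃* G') :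
    rank G' ≤ rank G := by
  refine le_sInf ?_
  rintro _ ⟨S, hS, rfl⟩
  refine sInf_le ⟨e '' S, ?_, e.injective.encard_image S⟩
  have := MonoidHom.map_closure e.toMonoidHom S
  rw [hS, ← MonoidHom.range_eq_map, MonoidHom.range_eq_top.2 e.surjective] at this
  exact this.symm

theorem rank_congr {G G' : Type*} [Group G] [Group G'] (e : G ≃* G') : rank G = rank G' :=
  le_antisymm (rank_le_of_mulEquiv e.symm) (rank_le_of_mulEquiv e)

theorem rank_le_encard {G : Type*} [Group G] {H : Subgroup G} {S : Set G}
    (hS : Subgroup.closure S = H) : rank H ≤ S.encard := by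
  subst hS
  refine sInf_le ⟨((↑) : Subgroup.closure S → G) ⁻¹' S, Subgroup.closure_closure_coe_preimage, ?_⟩
  rw [Set.encard_preimage_of_injective_subset_range Subtype.val_injective]
  simp

theorem exists_generators_encard {G : Type*} [Group G] (H : Subgroup G) :
    ∃ S : Set G, Subgroup.closure S = H ∧ S.encard = rank H := by
  obtain ⟨S, hS, hr⟩ : rank H ∈ {n : ℕ∞ | ∃ S : Set H, Subgroup.closure S = ⊤ ∧ S.encard = n} :=
    csInf_mem ⟨_, Set.univ, Subgroup.closure_univ, rfl⟩
  refine ⟨(↑) '' S, ?_, by rw [Subtype.val_injective.encard_image, hr]⟩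
  have := MonoidHom.map_closure H.subtype S
  rw [hS, ← MonoidHom.range_eq_map, Subgroup.range_subtype] at this
  exact this.symm

theorem rank_map {G G' : Type*} [Group G] [Group G'] (f : G →* G') (hf : Function.Injective f)
    (H : Subgroup G) : rank (H.map f) = rank H :=
  (rank_congr (H.equivMapOfInjective f hf)).symm

theorem fg_map {G G' : Type*} [Group G] [Group G'] (f : G →* G') {H : Subgroup G} (hH : H.FG) :
    (H.map f).FG := by
  classical
  obtain ⟨S, hS⟩ := hH
  exact ⟨S.image f, by rw [Finset.coe_image, ← MonoidHom.map_closure, hS]⟩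

theorem rank_le_one_of_isCyclic {G : Type*} [Group G] (H : Subgroup G) [IsCyclic H] :
    rank H ≤ 1 := by
  obtain ⟨g, hg⟩ := (Subgroup.isCyclic_iff_exists_zpowers_eq_top H).1 ‹_›
  rw [Subgroup.zpowers_eq_closure] at hg
  simpa using rank_le_encard hg

theorem two_le_rank_of_not_commute {G : Type*} [Group G] {H : Subgroup G} {g h : G} (hg : g ∈ H)
    (hh : h ∈ H) (hgh : ¬ Commute g h) : 2 ≤ rank H := by
  obtain ⟨S, hS, hr⟩ := exists_generators_encard H
  rw [← hr]
  by_contra! hlt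
  apply hgh
  have h1 : S.encard ≤ 1 := by
    rw [← one_add_one_eq_two] at hlt
    exact Order.lt_add_one_iff_of_not_isMax (by simp) |>.1 hlt
  have h2 : ∃ x, S ⊆ {x} := by
    rcases S.eq_empty_or_nonempty with rfl | ⟨x, hx⟩
    · exact ⟨1, by simp⟩
    · exact ⟨x, fun y hy => Set.encard_le_one_iff.1 h1 y x hy hx⟩
  obtain ⟨x, hx⟩ := h2
  have h3 : H ≤ Subgroup.zpowers x := by
    rw [← hS, Subgroup.zpowers_eq_closure]
    exact Subgroup.closure_mono hx
  obtain ⟨m, rfl⟩ := h3 hg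
  obtain ⟨n, rfl⟩ := h3 hh
  exact (Commute.refl x).zpow_zpow m n

end Rank

/-! ### Reduced rank of stabilizers through the Euler characteristic. -/

section EulerCharacteristic

variable {T : Type*}

/-- The opposite of the Euler characteristic of a free product of finite groups. -/
noncomputable def negEuler [Fintype T] (M : T → Type*) : ℝ :=
  Fintype.card T - 1 - ∑ t, (1 : ℝ) / Nat.card (M t)

variable {M : T → Type*} [∀ t, Group (M t)] {X : Type*} [MulAction (CoprodI M) X]

theorem iSup_factorRange : ⨆ t, factorRange M t = ⊤ := by
  rw [← CoprodI.range_eq_iSup, CoprodI.lift_of', MonoidHom.range_eq_top]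
  exact Function.surjective_id

variable (M X) in
/-- The factors act freely. -/
def FactorsActFreely : Prop :=
  ∀ t (m : M t) (x : X), (of m : CoprodI M) • x = x → m = 1

variable [Fintype T] [Fintype X]

theorem FactorsActFreely.card_orbits [∀ t, Finite (M t)] (hfree : FactorsActFreely M X) :
    (Fintype.card (Orbits (factorRange M) X) : ℝ) =
      Fintype.card X * ∑ t, (1 : ℝ) / Nat.card (M t) := by
  classical
  rw [← Nat.card_eq_fintype_card, Nat.card_sigma, Nat.cast_sum, Finset.mul_sum]
  refine Finset.sum_congr rfl fun t _ => ?_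
  have hst : ∀ x : X, MulAction.stabilizer (factorRange M t) x = ⊥ := by
    intro x
    rw [eq_bot_iff]
    rintro ⟨_, m, rfl⟩ hm
    have : m = 1 := hfree t m x hm
    subst this
    exact Subtype.ext (map_one _)
  have h1 := Nat.card_congr (MulAction.selfEquivOrbitsQuotientProd hst)
  rw [Nat.card_prod, Nat.card_eq_fintype_card (α := X)] at h1
  have h2 : Nat.card (factorRange M t) = Nat.card (M t) :=
    (Nat.card_congr (MonoidHom.ofInjective (CoprodI.of_injective t)).toEquiv).symm
  rw [h2] at h1
  have h3 : (Nat.card (M t) : ℝ) ≠ 0 := Nat.cast_ne_zero.2 Nat.card_pos.ne'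
  rw [h1]
  push_cast
  field_simp

/-- The upper and lower bounds on the number of generators agree, and free orbits of the factor `t`
have `|M t|` points each. The condition `0 ≤ negEuler M` forces the rank to be at least one, so that
truncated subtraction loses nothing. -/
theorem FactorsActFreely.rank_stabilizer [Nonempty T] [∀ t, Finite (M t)]
    [MulAction.IsPretransitive (CoprodI M) X] (hfree : FactorsActFreely M X)
    (he : 0 ≤ negEuler M) (x₀ : X) :
    (MulAction.stabilizer (CoprodI M) x₀).FG ∧
    ∃ r : ℕ, reducedRank (MulAction.stabilizer (CoprodI M) x₀) = r ∧
      (r : ℝ) = Fintype.card X * negEuler M := by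
  classical
  obtain ⟨S, hS, hcard⟩ := exists_generators_stabilizer (R := factorRange M) iSup_factorRange
    (fun t r hr x hx => by
      obtain ⟨m, rfl⟩ := hr
      rw [hfree t m x hx, map_one]) x₀
  refine ⟨⟨S, hS⟩, ?_⟩
  have hlow := le_card_generators_stabilizer x₀ S hS
  have horb := hfree.card_orbits
  have hreal : (S.card : ℝ) = Fintype.card X * negEuler M + 1 := by
    have h1 : (S.card : ℝ) + Fintype.card X + Fintype.card (Orbits (factorRange M) X) =
        Fintype.card T * Fintype.card X + 1 := by exact_mod_cast le_antisymm hcard hlow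
    rw [horb] at h1
    rw [negEuler]
    linarith
  have hpos : 1 ≤ S.card := by
    have : (1 : ℝ) ≤ S.card := by
      rw [hreal]
      have := mul_nonneg (Nat.cast_nonneg (α := ℝ) (Fintype.card X)) he
      linarith
    exact_mod_cast this
  have hrank : rank (MulAction.stabilizer (CoprodI M) x₀) = S.card := by
    apply le_antisymm
    · simpa using rank_le_encard hS
    · obtain ⟨S', hS', hr⟩ := exists_generators_encard (MulAction.stabilizer (CoprodI M) x₀)
      rw [← hr]
      by_cases hfin : S'.Finite
      · have := le_card_generators_stabilizer x₀ hfin.toFinset (by simpa using hS')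
        rw [hfin.encard_eq_coe_toFinset_card]
        have : S.card ≤ hfin.toFinset.card := by omega
        exact_mod_cast this
      · rw [Set.encard_eq_top hfin]
        exact le_top
  refine ⟨S.card - 1, ?_, ?_⟩
  · rw [reducedRank, hrank]
    rfl
  · rw [Nat.cast_sub hpos, hreal]
    simp

end EulerCharacteristic

/-! ### From pairs of finite actions to ratios of reduced ranks. -/

section Ratio

variable {J : Type*} (B : J → Type*) [∀ j, Group (B j)]

variable {B} in
/-- The subgroup `H` meets every conjugate of every factor trivially. -/
def MeetsFactorsTrivially (H : Subgroup (CoprodI B)) : Prop :=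
  ∀ h ∈ H, ∀ (i : J) (b : B i), IsConj h (of b) → h = 1

/-- The ratio of reduced ranks is at least `x` for some pair of finitely generated subgroups
meeting the conjugates of the factors trivially. -/
def HasRatio (x : ℝ≥0∞) : Prop :=
  ∃ H K : Subgroup (CoprodI B), H.FG ∧ K.FG ∧ MeetsFactorsTrivially H ∧ MeetsFactorsTrivially K ∧
    reducedRank H * reducedRank K ≠ 0 ∧
    x ≤ (reducedRank (H ⊓ K : Subgroup (CoprodI B)) : ℝ≥0∞) /
      ((reducedRank H : ℝ≥0∞) * (reducedRank K : ℝ≥0∞))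

variable {B} {T : Type*} [Nonempty T] {L : T → Subgroup (CoprodI B)}
  {y : T → CoprodI B} {j : T → J}

/-- A stabilizer element conjugate into a factor is conjugate to some `m` in `L t`; then `m` fixes a
translate of `x₀`, and freeness gives `m = 1`. -/
theorem GoodPosition.meetsFactorsTrivially (h : GoodPosition L y j) {X : Type*}
    [MulAction (CoprodI fun t => L t) X] (hfree : FactorsActFreely (fun t => L t) X) (x₀ : X) :
    MeetsFactorsTrivially
      ((MulAction.stabilizer (CoprodI fun t => L t) x₀).map (toGroup L)) := by
  rintro _ ⟨g, hg, rfl⟩ i b hb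
  obtain ⟨t, m, hm⟩ := h.isConj_of g b hb
  obtain ⟨c, hc⟩ := isConj_iff.1 hm
  have h1 : m = 1 := by
    apply hfree t m (c • x₀)
    rw [← hc, mul_smul, mul_smul, inv_smul_smul, MulAction.mem_stabilizer_iff.1 hg]
  rw [h1, map_one, isConj_comm, isConj_one_right] at hm
  rw [hm, map_one]

/-- Joint transitivity makes the intersection the stabilizer of a pair in a transitive action on `X
× Y`, so the three reduced ranks are `|X|`, `|Y|` and `|X||Y|` times `negEuler`. -/
theorem GoodPosition.hasRatio [Fintype T] (h : GoodPosition L y j) [∀ t, Finite (L t)]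
    {X Y : Type*} [Fintype X] [Fintype Y] [MulAction (CoprodI fun t => L t) X]
    [MulAction (CoprodI fun t => L t) Y] (hX : FactorsActFreely (fun t => L t) X)
    (hY : FactorsActFreely (fun t => L t) Y)
    (x₀ : X) (y₀ : Y) (htrans : ∀ x z, ∃ g : CoprodI fun t => L t, g • x₀ = x ∧ g • y₀ = z)
    (he : 0 < negEuler (fun t => L t)) :
    HasRatio B (ENNReal.ofReal (1 / negEuler (fun t => L t))) := by
  have : MulAction.IsPretransitive (CoprodI fun t => L t) X :=
    (MulAction.isPretransitive_iff_base x₀).2 fun x => (htrans x y₀).imp fun g hg => hg.1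
  have : MulAction.IsPretransitive (CoprodI fun t => L t) Y :=
    (MulAction.isPretransitive_iff_base y₀).2 fun z => (htrans x₀ z).imp fun g hg => hg.2
  have : MulAction.IsPretransitive (CoprodI fun t => L t) (X × Y) :=
    (MulAction.isPretransitive_iff_base (x₀, y₀)).2 fun p =>
      (htrans p.1 p.2).imp fun g hg => Prod.ext hg.1 hg.2
  have hXY : FactorsActFreely (fun t => L t) (X × Y) := fun t m p hp =>
    hX t m p.1 (congrArg Prod.fst hp)
  obtain ⟨hfg1, r1, hr1, hr1'⟩ := hX.rank_stabilizer he.le x₀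
  obtain ⟨hfg2, r2, hr2, hr2'⟩ := hY.rank_stabilizer he.le y₀
  obtain ⟨-, r3, hr3, hr3'⟩ := hXY.rank_stabilizer he.le (x₀, y₀)
  have hst : MulAction.stabilizer (CoprodI fun t => L t) (x₀, y₀) =
      MulAction.stabilizer _ x₀ ⊓ MulAction.stabilizer _ y₀ := by
    ext g
    simp [Subgroup.mem_inf, Prod.ext_iff]
  have hinj := h.toGroup_injective
  have hred : ∀ (N : Subgroup (CoprodI fun t => L t)),
      reducedRank (N.map (toGroup L)) = reducedRank N := fun N => by
    rw [reducedRank, reducedRank, rank_map _ hinj]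
  have hcX : (0 : ℝ) < Fintype.card X := by
    exact_mod_cast Fintype.card_pos_iff.2 ⟨x₀⟩
  have hcY : (0 : ℝ) < Fintype.card Y := by
    exact_mod_cast Fintype.card_pos_iff.2 ⟨y₀⟩
  have hp1 : (0 : ℝ) < r1 := by rw [hr1']; positivity
  have hp2 : (0 : ℝ) < r2 := by rw [hr2']; positivity
  refine ⟨_, _, fg_map (toGroup L) hfg1, fg_map (toGroup L) hfg2, h.meetsFactorsTrivially hX x₀,
    h.meetsFactorsTrivially hY y₀, ?_, ?_⟩
  · rw [hred, hred, hr1, hr2]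
    have h1 : r1 ≠ 0 := by rintro rfl; simp at hp1
    have h2 : r2 ≠ 0 := by rintro rfl; simp at hp2
    simp [h1, h2]
  · rw [← Subgroup.map_inf _ _ _ hinj, hred, hred, hred, ← hst, hr1, hr2, hr3]
    have h1 : 1 / negEuler (fun t => L t) = (r3 : ℝ) / (r1 * r2) := by
      rw [hr1', hr2', hr3', Fintype.card_prod]
      push_cast
      field_simp
    rw [h1, ENNReal.ofReal_div_of_pos (by positivity), ENNReal.ofReal_mul (by positivity)]
    simp

theorem HasRatio.mono {x z : ℝ≥0∞} (h : HasRatio B x) (hz : z ≤ x) : HasRatio B z := by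
  obtain ⟨H, K, h1, h2, h3, h4, h5, h6⟩ := h
  exact ⟨H, K, h1, h2, h3, h4, h5, hz.trans h6⟩

end Ratio

/-! ### Actions given by homomorphisms to finite groups. -/

section Actions

theorem factorsActFreely_of_hom {T : Type*} {M : T → Type*} [∀ t, Group (M t)] {Q : Type*} [Group Q]
    (π : ∀ t, M t →* Q) (hπ : ∀ t, Function.Injective (π t)) :
    letI := MulAction.compHom Q (CoprodI.lift π)
    FactorsActFreely M Q := by
  intro t m x hx
  change CoprodI.lift π (of m) * x = x at hx
  rw [CoprodI.lift_of, mul_eq_right] at hx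
  exact hπ t (hx.trans (map_one _).symm)

variable {J : Type*} {B : J → Type*} [∀ j, Group (B j)] {T : Type*} [Nonempty T] [Fintype T]
  {L : T → Subgroup (CoprodI B)} {y : T → CoprodI B} {j : T → J} [∀ t, Finite (L t)]

/-- The actions are by translation on `Q` and `R`, so the stabilizers are kernels, and `hsurj` is
transitivity on the product. -/
theorem GoodPosition.hasRatio_of_homs (h : GoodPosition L y j) {Q R : Type*} [Group Q] [Group R]
    [Finite Q] [Finite R] (π : ∀ t, L t →* Q) (ρ : ∀ t, L t →* R)
    (hπ : ∀ t, Function.Injective (π t)) (hρ : ∀ t, Function.Injective (ρ t))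
    (hsurj : ∀ q r, ∃ g, CoprodI.lift π g = q ∧ CoprodI.lift ρ g = r)
    (he : 0 < negEuler (fun t => L t)) :
    HasRatio B (ENNReal.ofReal (1 / negEuler (fun t => L t))) := by
  let := Fintype.ofFinite Q
  let := Fintype.ofFinite R
  let := MulAction.compHom Q (CoprodI.lift π)
  let := MulAction.compHom R (CoprodI.lift ρ)
  refine h.hasRatio (X := Q) (Y := R) (factorsActFreely_of_hom π hπ)
    (factorsActFreely_of_hom ρ hρ) 1 1 ?_ he
  intro q r
  obtain ⟨g, rfl, rfl⟩ := hsurj q r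
  exact ⟨g, mul_one _, mul_one _⟩

/-- An element fixing some point of `Y` is conjugate into the stabilizer of `y₀`, and conjugation is
invisible in the commutative group `Q`. Hence the stabilizer of `y₀` maps onto `Q`, which yields
transitivity on `Q × Y`. -/
theorem GoodPosition.hasRatio_of_hom_of_fixed (h : GoodPosition L y j) {Q Y : Type*} [CommGroup Q]
    [Finite Q] [Fintype Y] [Nonempty Y] [MulAction (CoprodI fun t => L t) Y]
    [MulAction.IsPretransitive (CoprodI fun t => L t) Y] (π : ∀ t, L t →* Q)
    (hπ : ∀ t, Function.Injective (π t)) (hY : FactorsActFreely (fun t => L t) Y)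
    (S : Set (CoprodI fun t => L t)) (hS : ∀ g ∈ S, ∃ z : Y, g • z = z)
    (hSQ : Subgroup.closure (CoprodI.lift π '' S) = ⊤)
    (he : 0 < negEuler (fun t => L t)) :
    HasRatio B (ENNReal.ofReal (1 / negEuler (fun t => L t))) := by
  let := Fintype.ofFinite Q
  let := MulAction.compHom Q (CoprodI.lift π)
  obtain ⟨y₀⟩ := ‹Nonempty Y›
  refine h.hasRatio (X := Q) (Y := Y) (factorsActFreely_of_hom π hπ) hY 1 y₀ ?_ he
  have hst : (MulAction.stabilizer (CoprodI fun t => L t) y₀).map (CoprodI.lift π) = ⊤ := by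
    rw [eq_top_iff, ← hSQ, Subgroup.closure_le]
    rintro _ ⟨g, hg, rfl⟩
    obtain ⟨z, hz⟩ := hS g hg
    obtain ⟨c, rfl⟩ := MulAction.exists_smul_eq (CoprodI fun t => L t) y₀ z
    refine ⟨c⁻¹ * g * c, ?_, ?_⟩
    · change _ • _ = _
      rw [mul_smul, mul_smul, hz, inv_smul_smul]
    · rw [map_mul, map_mul, map_inv, mul_comm, mul_inv_cancel_left]
  intro q z
  obtain ⟨g, rfl⟩ := MulAction.exists_smul_eq (CoprodI fun t => L t) y₀ z
  obtain ⟨k, hk, hkq⟩ : (CoprodI.lift π g)⁻¹ * q ∈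
      (MulAction.stabilizer (CoprodI fun t => L t) y₀).map (CoprodI.lift π) := by
    rw [hst]; trivial
  refine ⟨g * k, ?_, ?_⟩
  · change CoprodI.lift π (g * k) * 1 = q
    rw [mul_one, map_mul, hkq, mul_inv_cancel_left]
  · rw [mul_smul, MulAction.mem_stabilizer_iff.1 hk]

end Actions

/-! ### The actions for each choice of orders of the finite subgroups. -/

section Constructions

variable {J : Type*} {B : J → Type*} [∀ j, Group (B j)]

theorem nonempty_mulEquiv_zmod {G : Type*} [Group G] {p : ℕ} [Fact p.Prime]
    (h : Nat.card G = p) : Nonempty (G ≃* Multiplicative (ZMod p)) := by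
  have : IsCyclic G := isCyclic_of_prime_card h
  subst h
  exact ⟨(zmodCyclicMulEquiv this).symm⟩

/-- Two subgroups of the same odd prime order. -/
theorem GoodPosition.hasRatio_of_card_eq_prime {L : Bool → Subgroup (CoprodI B)}
    {y : Bool → CoprodI B} {j : Bool → J} (h : GoodPosition L y j) {p : ℕ} (hp : p.Prime)
    (hp2 : p ≠ 2) (hL : ∀ b, Nat.card (L b) = p) :
    HasRatio B (ENNReal.ofReal (p / (p - 2))) := by
  have : Fact p.Prime := ⟨hp⟩
  have hp3 : (3 : ℝ) ≤ p := by
    have := hp.two_le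
    exact_mod_cast (by omega : 3 ≤ p)
  have : ∀ b, Finite (L b) := fun b => Nat.finite_of_card_ne_zero (by rw [hL]; exact hp.ne_zero)
  have he : negEuler (fun b => L b) = (p - 2) / p := by
    simp only [negEuler, hL, Fintype.card_bool, Fintype.sum_bool]
    field_simp
    ring
  let f : ∀ b, L b ≃* Multiplicative (ZMod p) := fun b => (nonempty_mulEquiv_zmod (hL b)).some
  -- Jointly the two homomorphisms send a pair `(u, v)` to `(u * v, u * v⁻¹)`, which is onto because
  -- squaring is bijective in odd order `p`. Below, `u` is the square root `(q * r) ^ ((p + 1) /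
  -- 2)`.
  have hratio := h.hasRatio_of_homs (fun b => (f b).toMonoidHom)
    (fun b => if b then (f b).toMonoidHom else (f b).toMonoidHom⁻¹)
    (fun b => (f b).injective) (by
      intro b
      cases b
      · exact inv_injective.comp (f false).injective
      · exact (f true).injective) (by
      intro q r
      have hodd : 2 * ((p + 1) / 2) = p + 1 :=
        Nat.mul_div_cancel' (hp.odd_of_ne_two hp2).add_one.two_dvd
      have hu : (q * r) ^ ((p + 1) / 2) * (q * r) ^ ((p + 1) / 2) = q * r := by
        have hpow : (q * r) ^ p = 1 := by
          have := pow_card_eq_one' (x := q * r)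
          rwa [Nat.card_congr Multiplicative.toAdd, Nat.card_zmod] at this
        rw [← pow_add, ← two_mul, hodd, pow_succ, hpow, one_mul]
      set u := (q * r) ^ ((p + 1) / 2)
      refine ⟨of (M := fun b => L b) (i := true) ((f true).symm u) *
        of (M := fun b => L b) (i := false) ((f false).symm (u⁻¹ * q)), ?_, ?_⟩
      · rw [map_mul, CoprodI.lift_of, CoprodI.lift_of]
        simp
      · rw [map_mul, CoprodI.lift_of, CoprodI.lift_of]
        simp only [if_true, Bool.false_eq_true, if_false, MonoidHom.inv_apply,
          MulEquiv.toMonoidHom_eq_coe, MonoidHom.coe_coe, MulEquiv.apply_symm_apply, mul_inv_rev,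
          inv_inv]
        rw [mul_left_comm, hu, inv_mul_cancel_left]) (by
      rw [he]
      apply div_pos <;> linarith)
  rw [he, one_div_div] at hratio
  exact hratio

/-- Three subgroups of order two. -/
theorem GoodPosition.hasRatio_two {L : Fin 3 → Subgroup (CoprodI B)}
    {y : Fin 3 → CoprodI B} {j : Fin 3 → J} (h : GoodPosition L y j)
    (hL : ∀ t, Nat.card (L t) = 2) : HasRatio B 2 := by
  have : ∀ t, Finite (L t) := fun b => Nat.finite_of_card_ne_zero (by rw [hL]; norm_num)
  have he : negEuler (fun t => L t) = 1 / 2 := by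
    simp only [negEuler, hL, Fintype.card_fin, Fin.sum_univ_three]
    norm_num
  let f : ∀ t, L t ≃* Multiplicative (ZMod 2) := fun t => (nonempty_mulEquiv_zmod (hL t)).some
  let C := Multiplicative (ZMod 2)
  -- Together with the first homomorphism, the three generators go to `(1,1,0)`, `(1,0,1)`,
  -- `(1,1,1)`, a basis of the three-dimensional space over the field with two elements.
  let v : Fin 3 → (C →* C × C) :=
    ![MonoidHom.inl C C, MonoidHom.inr C C, (MonoidHom.id C).prod (MonoidHom.id C)]
  have hratio := h.hasRatio_of_homs (fun t => (f t).toMonoidHom)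
    (fun t => (v t).comp (f t).toMonoidHom) (fun t => (f t).injective) (by
      intro t
      have hv : Function.Injective (v t) := by
        fin_cases t
        · exact fun a b hab => congrArg Prod.fst hab
        · exact fun a b hab => congrArg Prod.snd hab
        · exact fun a b hab => congrArg Prod.fst hab
      exact hv.comp (f t).injective) (by
      rintro q ⟨r, s⟩
      have hsq : ∀ c : C, c * c = 1 := by decide
      refine ⟨of (M := fun t => L t) (i := 0) ((f 0).symm (r * (q * r * s))) *
        of (M := fun t => L t) (i := 1) ((f 1).symm (s * (q * r * s))) *
        of (M := fun t => L t) (i := 2) ((f 2).symm (q * r * s)), ?_, ?_⟩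
      · rw [map_mul, map_mul, CoprodI.lift_of, CoprodI.lift_of, CoprodI.lift_of]
        simp only [MulEquiv.toMonoidHom_eq_coe, MonoidHom.coe_coe, MulEquiv.apply_symm_apply]
        revert q r s
        decide
      · rw [map_mul, map_mul, CoprodI.lift_of, CoprodI.lift_of, CoprodI.lift_of]
        simp only [MulEquiv.toMonoidHom_eq_coe, MonoidHom.coe_comp, MonoidHom.coe_coe,
          Function.comp_apply, MulEquiv.apply_symm_apply]
        revert q r s
        decide) (by
      rw [he]; norm_num)
  rw [he] at hratio
  norm_num at hratio
  exact hratio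

theorem exists_hom_of_card_eq_two {S W : Type*} [Group S] [Group W] (hS : Nat.card S = 2) {τ : W}
    (hτ : τ * τ = 1) : ∃ f : S →* W, ∀ s ≠ 1, f s = τ := by
  classical
  have hmul : ∀ s t : S, s ≠ 1 → t ≠ 1 → s * t = 1 := by
    intro s t hs ht
    obtain ⟨z, -, hz⟩ := (Nat.card_eq_two_iff' (1 : S)).1 hS
    have hst : s = t := (hz s hs).trans (hz t ht).symm
    subst hst
    by_contra hss
    exact hs (mul_eq_left.1 ((hz _ hss).trans (hz _ hs).symm))
  refine ⟨MonoidHom.mk' (fun s => if s = 1 then 1 else τ) ?_, fun s hs => if_neg hs⟩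
  intro s t
  by_cases hs : s = 1
  · simp [hs]
  · by_cases ht : t = 1
    · simp [ht]
    · simp [hs, ht, hmul s t hs ht, hτ]

section Doubling

variable {Λ : Type*} [Group Λ]

/-- The involution of two copies of `Λ` that exchanges `1` and `l` in each copy and otherwise
exchanges the copies. -/
def crossing [DecidableEq Λ] (l : Λ) : Λ × Bool → Λ × Bool := fun p =>
  if p.1 = 1 then (l, p.2) else if p.1 = l then (1, p.2) else (p.1, !p.2)

theorem crossing_involutive [DecidableEq Λ] {l : Λ} (hl : l ≠ 1) : Function.Involutive (crossing l) := by
  rintro ⟨x, b⟩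
  unfold crossing
  by_cases hx : x = 1
  · simp [hx, hl]
  · by_cases hxl : x = l
    · simp [hxl, hl]
    · simp [hx, hxl]

theorem crossing_ne [DecidableEq Λ] {l : Λ} (hl : l ≠ 1) (p : Λ × Bool) : crossing l p ≠ p := by
  obtain ⟨x, b⟩ := p
  unfold crossing
  by_cases hx : x = 1
  · simp [hx, hl]
  · by_cases hxl : x = l
    · simp [hxl, hl, Ne.symm hl]
    · simp [hx, hxl]

/-- The action of `Λ` on two copies of itself, by left translation on the first one, and by a
conjugate of left translation on the second one. -/
def twistedHom (w : Equiv.Perm Λ) : Λ →* Equiv.Perm (Λ × Bool) where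
  toFun l :=
    { toFun := fun p => (if p.2 then l * p.1 else w.symm (l * w p.1), p.2)
      invFun := fun p => (if p.2 then l⁻¹ * p.1 else w.symm (l⁻¹ * w p.1), p.2)
      left_inv := by rintro ⟨x, _ | _⟩ <;> simp
      right_inv := by rintro ⟨x, _ | _⟩ <;> simp }
  map_one' := by ext ⟨x, _ | _⟩ <;> simp
  map_mul' l k := by ext ⟨x, _ | _⟩ <;> simp [mul_assoc]

end Doubling

/-- Besides translation on `Q`, the free product acts on two copies of `L false`, the involution `c`
acting by `crossing l₀`. Then `c * l₀` fixes `1` in the first copy and `c * l₁` fixes `1` in the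
second, and their images in `Q` generate it by `hgen`. -/
theorem GoodPosition.hasRatio_of_card_two_left {L : Bool → Subgroup (CoprodI B)}
    {y : Bool → CoprodI B} {j : Bool → J} (h : GoodPosition L y j) {n : ℕ} (hn : 3 ≤ n)
    (h2 : Nat.card (L true) = 2) (hLn : Nat.card (L false) = n) {Q : Type*} [CommGroup Q]
    [Finite Q] (ι : L false →* Q) (hι : Function.Injective ι) {a : Q} (ha : a * a = 1)
    (ha1 : a ≠ 1) {l₀ l₁ : L false} (hl₀ : l₀ ≠ 1) (hl₁ : l₁ ≠ 1)
    (hgen : Subgroup.closure {a * ι l₀, a * ι l₁} = ⊤) :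
    HasRatio B (ENNReal.ofReal (2 * n / (n - 2))) := by
  classical
  have hn' : (3 : ℝ) ≤ n := by exact_mod_cast hn
  have hfin : ∀ b, Finite (L b) := fun b => Nat.finite_of_card_ne_zero (by
    cases b
    · rw [hLn]; omega
    · rw [h2]; norm_num)
  have he : negEuler (fun b => L b) = (n - 2) / (2 * n) := by
    simp only [negEuler, hLn, h2, Fintype.card_bool, Fintype.sum_bool]
    field_simp
    push_cast
    ring
  obtain ⟨c, hc, hcu⟩ := (Nat.card_eq_two_iff' (1 : L true)).1 h2
  obtain ⟨α, hα⟩ := exists_hom_of_card_eq_two h2 ha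
  let Y := L false × Bool
  let τ : Equiv.Perm Y := (crossing_involutive hl₀).toPerm
  obtain ⟨β, hβ⟩ := exists_hom_of_card_eq_two (S := L true) h2 (τ := τ) (by
    ext1 p
    exact crossing_involutive hl₀ p)
  -- Twisting by this swap makes `l₁` carry `1` to `l₀` in the second copy, from where `crossing l₀`
  -- returns it to `1`.
  let w : Equiv.Perm (L false) := Equiv.swap l₀ l₁
  let ρ : ∀ b, L b →* Equiv.Perm Y := fun b =>
    match b with
    | true => β
    | false => twistedHom w
  let π : ∀ b, L b →* Q := fun b =>
    match b with
    | true => α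
    | false => ι
  let : Fintype Y := Fintype.ofFinite Y
  let : MulAction (CoprodI fun b => L b) Y := MulAction.compHom Y (CoprodI.lift ρ)
  have hsmul : ∀ b (m : L b) (z : Y), (of m : CoprodI fun b => L b) • z = ρ b m z := by
    intro b m z
    change CoprodI.lift ρ (of m) z = _
    rw [CoprodI.lift_of]
  have hw1 : w 1 = 1 := Equiv.swap_apply_of_ne_of_ne hl₀.symm hl₁.symm
  have hcz : ∀ z : Y, (of (i := true) c : CoprodI fun b => L b) • z = crossing l₀ z := by
    intro z
    rw [hsmul]
    change β c z = _
    rw [hβ c hc]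
    rfl
  have hlt : ∀ l x : L false, (of (i := false) l : CoprodI fun b => L b) • ((x, true) : Y) =
      ((l * x, true) : Y) := fun l x => hsmul false l _
  have hlf : ∀ l x : L false, (of (i := false) l : CoprodI fun b => L b) • ((x, false) : Y) =
      ((w.symm (l * w x), false) : Y) := fun l x => hsmul false l _
  have hfree : FactorsActFreely (fun b => L b) Y := by
    intro b m z hz
    rw [hsmul] at hz
    cases b
    · obtain ⟨x, _ | _⟩ := z
      · have h1 := congrArg Prod.fst hz
        change w.symm (m * w x) = x at h1
        rw [Equiv.symm_apply_eq, mul_eq_right] at h1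
        exact h1
      · have h1 := congrArg Prod.fst hz
        change m * x = x at h1
        exact mul_eq_right.1 h1
    · by_contra hm
      change β m z = z at hz
      rw [hβ m hm] at hz
      exact crossing_ne hl₀ z hz
  have hπ : ∀ b, Function.Injective (π b) := by
    intro b
    cases b
    · exact hι
    · rw [injective_iff_map_eq_one]
      intro s hs
      by_contra hs1
      exact ha1 ((hα s hs1).symm.trans hs)
  -- Only at points other than `1` and `l₀` does the crossing exchange the copies; transitivity
  -- needs one, hence `3 ≤ n`.
  obtain ⟨z, hz1, hz0⟩ : ∃ z : L false, z ≠ 1 ∧ z ≠ l₀ := by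
    by_contra! hall
    let := Fintype.ofFinite (L false)
    have h1 : (Finset.univ : Finset (L false)) ⊆ {1, l₀} := fun z _ => by
      by_cases hz : z = 1
      · simp [hz]
      · simp [hall z hz]
    have h3 := (Finset.card_le_card h1).trans Finset.card_le_two
    rw [Finset.card_univ, ← Nat.card_eq_fintype_card, hLn] at h3
    omega
  have htrans : MulAction.IsPretransitive (CoprodI fun b => L b) Y := by
    rw [MulAction.isPretransitive_iff_base ((1, true) : Y)]
    rintro ⟨x, _ | _⟩
    · refine ⟨of (i := false) (w x * (w z)⁻¹) * (of (i := true) c * of (i := false) z), ?_⟩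
      rw [mul_smul, mul_smul, hlt, hcz]
      have : crossing l₀ (z * 1, true) = (z, false) := by simp [crossing, hz1, hz0]
      rw [this, hlf]
      simp
    · exact ⟨of (i := false) x, by rw [hlt, mul_one]⟩
  have hratio := h.hasRatio_of_hom_of_fixed (Y := Y) π hπ hfree
    {of (i := true) c * of (i := false) l₀, of (i := true) c * of (i := false) l₁} (by
      rintro g (rfl | rfl)
      · refine ⟨(1, true), ?_⟩
        rw [mul_smul, hlt, hcz]
        simp [crossing, hl₀]
      · refine ⟨(1, false), ?_⟩
        rw [mul_smul, hlf, hcz, hw1]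
        have : w.symm (l₁ * 1) = l₀ := by simp [w]
        rw [this]
        simp [crossing, hl₀]) (by
      rw [Set.image_pair, map_mul, map_mul]
      simp only [CoprodI.lift_of]
      change Subgroup.closure {α c * ι l₀, α c * ι l₁} = ⊤
      rw [hα c hc, hgen]) (by
      rw [he]
      apply div_pos <;> linarith)
  rw [he, one_div_div] at hratio
  exact hratio

/-- A subgroup of order two and a subgroup of odd prime order. -/
theorem GoodPosition.hasRatio_of_card_two_prime {L : Bool → Subgroup (CoprodI B)}
    {y : Bool → CoprodI B} {j : Bool → J} (h : GoodPosition L y j) {p : ℕ} (hp : p.Prime)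
    (hp2 : p ≠ 2) (h2 : Nat.card (L true) = 2) (hL : Nat.card (L false) = p) :
    HasRatio B (ENNReal.ofReal (2 * p / (p - 2))) := by
  have : Fact p.Prime := ⟨hp⟩
  obtain ⟨f⟩ := nonempty_mulEquiv_zmod hL
  let C := Multiplicative (ZMod 2)
  let D := Multiplicative (ZMod p)
  let a : C := Multiplicative.ofAdd 1
  let d : D := Multiplicative.ofAdd 1
  have haa : a * a = 1 := by decide
  have hd : d ≠ 1 := by
    intro h1
    have : (1 : ZMod p) = 0 := h1
    exact one_ne_zero this
  have hdp : d ^ p = 1 := by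
    have := pow_card_eq_one' (x := d)
    rwa [Nat.card_congr Multiplicative.toAdd, Nat.card_zmod] at this
  have hfd : f.symm d ≠ 1 := fun h1 => hd (by
    rw [← f.apply_symm_apply d, h1, map_one])
  refine h.hasRatio_of_card_two_left (Q := C × D) (by have := hp.two_le; omega) h2 hL
    ((MonoidHom.inr C D).comp f.toMonoidHom) (fun s t hst => f.injective (congrArg Prod.snd hst))
    (a := (a, 1)) (by ext <;> simp [haa]) (by
      intro h1
      exact (by decide : a ≠ 1) (congrArg Prod.fst h1)) hfd hfd ?_
  set H : Subgroup (C × D) := Subgroup.closure _ with hH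
  have h1 : (a, d) ∈ H := by
    apply Subgroup.subset_closure
    left
    simp
  -- Both generators are `(a, d)`; its `p`-th power is `(a, 1)` because `p` is odd, which separates
  -- the two coordinates.
  have h3 : (a, (1 : D)) ∈ H := by
    have h4 := H.pow_mem h1 p
    have h5 : ((a, d) : C × D) ^ p = (a, 1) := by
      have hap : ∀ m, Odd m → a ^ m = a := by
        rintro _ ⟨k, rfl⟩
        rw [pow_succ, pow_mul, pow_two, haa, one_pow, one_mul]
      rw [Prod.pow_mk, hdp, hap p (hp.odd_of_ne_two hp2)]
    rwa [h5] at h4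
  have h4 : ((1 : C), d) ∈ H := by
    have := H.mul_mem h3 h1
    rwa [Prod.mk_mul_mk, haa, one_mul] at this
  rw [eq_top_iff]
  rintro ⟨u, v⟩ -
  have h5 : ((u, v) : C × D) = (a, 1) ^ (u.toAdd.val) * (1, d) ^ (v.toAdd.val) := by
    rw [Prod.pow_mk, Prod.pow_mk, Prod.mk_mul_mk, one_pow, one_pow, one_mul, mul_one]
    have key : ∀ (m : ℕ) [NeZero m] (z : Multiplicative (ZMod m)),
        z = (Multiplicative.ofAdd (1 : ZMod m)) ^ z.toAdd.val := by
      intro m _ z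
      rw [← ofAdd_nsmul]
      simp
    exact Prod.ext (key 2 u) (key p v)
  rw [h5]
  exact H.mul_mem (H.pow_mem h3 _) (H.pow_mem h4 _)

/-- A subgroup of order two and a subgroup of order four. -/
theorem GoodPosition.hasRatio_of_card_two_four {L : Bool → Subgroup (CoprodI B)}
    {y : Bool → CoprodI B} {j : Bool → J} (h : GoodPosition L y j)
    (h2 : Nat.card (L true) = 2) (hL : Nat.card (L false) = 4) :
    HasRatio B (ENNReal.ofReal (2 * (4 : ℕ) / ((4 : ℕ) - 2))) := by
  have : Fact (Nat.Prime 2) := ⟨Nat.prime_two⟩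
  have hfin : Finite (L false) := Nat.finite_of_card_ne_zero (by rw [hL]; norm_num)
  let : CommGroup (L false) :=
    IsPGroup.commGroupOfCardEqPrimeSq (p := 2) (by rw [hL]; norm_num)
  obtain ⟨s, hs⟩ := exists_prime_orderOf_dvd_card' (G := L false) 2 (by rw [hL]; norm_num)
  have hs1 : s ≠ 1 := by
    rintro rfl
    simp at hs
  have hss : s * s = 1 := by rw [← pow_two, ← hs, pow_orderOf_eq_one]
  obtain ⟨z, hz1, hzs⟩ : ∃ z : L false, z ≠ 1 ∧ z ≠ s := by
    classical
    by_contra! hall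
    let := Fintype.ofFinite (L false)
    have h1 : (Finset.univ : Finset (L false)) ⊆ {1, s} := fun z _ => by
      by_cases hz : z = 1
      · simp [hz]
      · simp [hall z hz]
    have h3 := (Finset.card_le_card h1).trans Finset.card_le_two
    rw [Finset.card_univ, ← Nat.card_eq_fintype_card, hL] at h3
    omega
  -- Here `Q` is the group of order four itself and `a = s` is an involution in it; with `l₀ = z`
  -- and `l₁ = s * z` the two required generators are `s * z` and `z`.
  refine h.hasRatio_of_card_two_left (by norm_num) h2 hL (MonoidHom.id (L false))
    Function.injective_id hss hs1 (l₀ := z) (l₁ := s * z) hz1 ?_ ?_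
  · intro h1
    apply hzs
    rw [← inv_eq_of_mul_eq_one_right h1, inv_eq_of_mul_eq_one_right hss]
  · set H : Subgroup (L false) := Subgroup.closure _ with hH
    have hzH : z ∈ H := by
      apply Subgroup.subset_closure
      right
      simp [← mul_assoc, hss]
    have hsH : s ∈ H := by
      have h1 : s * z ∈ H := Subgroup.subset_closure (Or.inl rfl)
      have h3 := H.mul_mem h1 (H.inv_mem hzH)
      rwa [mul_inv_cancel_right] at h3
    have h3 : 3 ≤ Nat.card H := by
      have h4 : ({1, s, z} : Set (L false)).ncard = 3 :=
        Set.ncard_eq_three.2 ⟨1, s, z, hs1.symm, hz1.symm, hzs.symm, rfl⟩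
      rw [← h4]
      change _ ≤ (H : Set (L false)).ncard
      refine Set.ncard_le_ncard ?_ (Set.toFinite _)
      rintro x (rfl | rfl | rfl)
      · exact H.one_mem
      · exact hsH
      · exact hzH
    have h4 := H.card_subgroup_dvd_card
    rw [hL] at h4
    apply Subgroup.eq_top_of_card_eq
    rw [hL]
    have h5 := Nat.le_of_dvd (by norm_num) h4
    interval_cases hc : Nat.card H
    · omega
    · rfl

end Constructions

/-! ### Moving finite subgroups of a free product into good position. -/

section Positions

variable {J : Type*} {B : J → Type*} [∀ j, Group (B j)]

/-- Nontrivial finite commutative subgroups of a free product are conjugate into a factor. -/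
theorem exists_conj_le_factorRange [Nonempty J] {L : Subgroup (CoprodI B)} [Finite L]
    [Nontrivial L] (hL : ∀ g ∈ L, ∀ h ∈ L, Commute g h) :
    ∃ (j : J) (L' : Subgroup (CoprodI B)), L' ≤ factorRange B j ∧ Nat.card L' = Nat.card L := by
  obtain ⟨⟨g, hg⟩, hg1⟩ := exists_ne (1 : L)
  have hgfin : IsOfFinOrder g :=
    L.subtype.isOfFinOrder (isOfFinOrder_of_finite (⟨g, hg⟩ : L))
  obtain ⟨j, b, hb⟩ := isConj_of_of_isOfFinOrder hgfin
  obtain ⟨c, hc⟩ := isConj_iff.1 hb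
  have hb1 : b ≠ 1 := by
    rintro rfl
    rw [map_one, conj_eq_one_iff] at hc
    exact hg1 (Subtype.ext hc)
  refine ⟨j, L.map (MulAut.conj c).toMonoidHom, ?_, ?_⟩
  · rintro _ ⟨l, hl, rfl⟩
    have h1 : Commute ((MulAut.conj c).toMonoidHom l) (of b) := by
      rw [← hc]
      exact (hL l hl g hg).map (MulAut.conj c).toMonoidHom
    obtain ⟨d, hd⟩ := mem_range_of_commute hb1 h1
    exact ⟨d, hd.symm⟩
  · exact (Nat.card_congr (L.equivMapOfInjective _ (MulAut.conj c).injective).toEquiv).symm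

theorem goodPosition_map_conj {T : Type*} {L : T → Subgroup (CoprodI B)} {j : T → J}
    (hL : ∀ t, L t ≤ factorRange B (j t)) (y : T → CoprodI B)
    (hy : ∀ s t, s ≠ t → ((y s)⁻¹ * y t = 1 ∧ j s ≠ j t) ∨
      ∃ i k, IsReduced i k 1 ((y s)⁻¹ * y t) ∧ j s ≠ i ∧ k ≠ j t) :
    GoodPosition (fun t => (L t).map (MulAut.conj (y t)).toMonoidHom) y j where
  conj := by
    rintro t _ ⟨m, hm, rfl⟩
    obtain ⟨b, hb⟩ := hL t hm
    refine ⟨b, ?_⟩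
    rw [hb]
    change (y t)⁻¹ * (y t * m * (y t)⁻¹) * y t = m
    group
  sep := hy

theorem card_map_conj (L : Subgroup (CoprodI B)) (y : CoprodI B) :
    Nat.card (L.map (MulAut.conj y).toMonoidHom) = Nat.card L :=
  (Nat.card_congr (L.equivMapOfInjective _ (MulAut.conj y).injective).toEquiv).symm

/-- Subgroups of distinct factors need no change; within one factor, one of them is conjugated by a
nontrivial element of another factor. The same subgroup may be used twice. -/
theorem exists_goodPosition_pair {L₀ L₁ : Subgroup (CoprodI B)} {j₀ j₁ : J}
    (h₀ : L₀ ≤ factorRange B j₀) (h₁ : L₁ ≤ factorRange B j₁)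
    (hnt : ∀ j, ∃ k ≠ j, Nontrivial (B k)) :
    ∃ (L : Bool → Subgroup (CoprodI B)) (y : Bool → CoprodI B) (j : Bool → J),
      GoodPosition L y j ∧ Nat.card (L true) = Nat.card L₀ ∧ Nat.card (L false) = Nat.card L₁ := by
  have hle : ∀ b : Bool, (if b then L₀ else L₁) ≤ factorRange B (if b then j₀ else j₁) := by
    rintro (_ | _)
    · exact h₁
    · exact h₀
  by_cases hj : j₀ = j₁
  · subst hj
    obtain ⟨k, hk, hnk⟩ := hnt j₀
    obtain ⟨x, hx⟩ := exists_ne (1 : B k)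
    refine ⟨_, _, _, goodPosition_map_conj hle (fun b => if b then of x else 1) ?_,
      card_map_conj _ _, card_map_conj _ _⟩
    have hred := isReduced_of (B := B) hx
    rintro (_ | _) (_ | _) hst
    · exact absurd rfl hst
    · exact Or.inr ⟨k, k, by simpa using hred, hk.symm, hk⟩
    · exact Or.inr ⟨k, k, by simpa using hred.inv, hk.symm, hk⟩
    · exact absurd rfl hst
  · refine ⟨_, _, _, goodPosition_map_conj hle (fun _ => 1) ?_,
      card_map_conj _ _, card_map_conj _ _⟩
    rintro (_ | _) (_ | _) hst
    · exact absurd rfl hst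
    · exact Or.inl ⟨by simp, fun h => hj h.symm⟩
    · exact Or.inl ⟨by simp, hj⟩
    · exact absurd rfl hst

/-- Three conjugates of a subgroup of order two of a factor. -/
theorem hasRatio_two_of_three_conj {L : Subgroup (CoprodI B)} {j : J} (hL : L ≤ factorRange B j)
    (h2 : Nat.card L = 2) {k l : J} {x : B k} {z : B l} (hx : x ≠ 1) (hz : z ≠ 1) (hk : k ≠ j)
    (hl : l ≠ j) (hxz : IsReduced k l 1 ((of x : CoprodI B)⁻¹ * of z)) : HasRatio B 2 := by
  refine (goodPosition_map_conj (T := Fin 3) (L := fun _ => L) (j := fun _ => j) (fun _ => hL)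
    ![1, of x, of z] ?_).hasRatio_two fun t => (card_map_conj _ _).trans h2
  have hxr := isReduced_of (B := B) hx
  have hzr := isReduced_of (B := B) hz
  have hzx := hxz.inv
  rw [mul_inv_rev, inv_inv] at hzx
  intro s t hst
  right
  fin_cases s <;> fin_cases t
  · exact absurd rfl hst
  · exact ⟨k, k, by simpa using hxr, hk.symm, hk⟩
  · exact ⟨l, l, by simpa using hzr, hl.symm, hl⟩
  · exact ⟨k, k, by simpa using hxr.inv, hk.symm, hk⟩
  · exact absurd rfl hst
  · exact ⟨k, l, by simpa using hxz, hk.symm, hl⟩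
  · exact ⟨l, l, by simpa using hzr.inv, hl.symm, hl⟩
  · exact ⟨l, k, by simpa using hzx, hl.symm, hk⟩
  · exact absurd rfl hst

theorem card_zpowers_eq_two {G : Type*} [Group G] {g : G} (hg : g ≠ 1) (hgg : g * g = 1) :
    Nat.card (Subgroup.zpowers g) = 2 := by
  rw [Nat.card_zpowers]
  exact orderOf_eq_prime (by rw [pow_two, hgg]) hg

variable (B) in
/-- The free product is the infinite dihedral group, as a free product of two groups of order
two. -/
def IsInfiniteDihedral : Prop :=
  ∃ j k, j ≠ k ∧ (∃ a : B j, a ≠ 1 ∧ ∀ x, x ≠ 1 → x = a) ∧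
    (∃ b : B k, b ≠ 1 ∧ ∀ x, x ≠ 1 → x = b) ∧ ∀ l, l ≠ j → l ≠ k → Subsingleton (B l)

/-- Three conjugates, by `1`, `x` and `z`, are in good position once `x ≠ z` are nontrivial elements
of factors other than that of `L`. If no such pair exists, the only other nontrivial factor has
order two; it can then replace `L` unless `B j` has order two as well, which is the infinite
dihedral case. -/
theorem hasRatio_two_of_card_eq_two (hnt : ∀ j, ∃ k ≠ j, Nontrivial (B k))
    (hD : ¬ IsInfiniteDihedral B) {L : Subgroup (CoprodI B)} {j : J} (hL : L ≤ factorRange B j)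
    (h2 : Nat.card L = 2) : HasRatio B 2 := by
  have key : ∀ (M : Subgroup (CoprodI B)) (i : J), M ≤ factorRange B i → Nat.card M = 2 →
      ∀ k ≠ i, ∀ x z : B k, x ≠ 1 → z ≠ 1 → x ≠ z → HasRatio B 2 := by
    intro M i hM hM2 k hk x z hx hz hxz
    refine hasRatio_two_of_three_conj hM hM2 hx hz hk hk ?_
    rw [← map_inv, ← map_mul]
    exact isReduced_of (by rwa [ne_eq, inv_mul_eq_one])
  by_cases h1 : ∃ k ≠ j, ∃ x z : B k, x ≠ 1 ∧ z ≠ 1 ∧ x ≠ z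
  · obtain ⟨k, hk, x, z, hx, hz, hxz⟩ := h1
    exact key L j hL h2 k hk x z hx hz hxz
  by_cases h3 : ∃ k l, k ≠ j ∧ l ≠ j ∧ k ≠ l ∧ Nontrivial (B k) ∧ Nontrivial (B l)
  · obtain ⟨k, l, hk, hl, hkl, _, _⟩ := h3
    obtain ⟨x, hx⟩ := exists_ne (1 : B k)
    obtain ⟨z, hz⟩ := exists_ne (1 : B l)
    exact hasRatio_two_of_three_conj hL h2 hx hz hk hl
      (((isReduced_of hx).inv.mul hkl (isReduced_of hz)).mono (by norm_num))
  push Not at h1 h3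
  obtain ⟨k, hk, hnk⟩ := hnt j
  obtain ⟨b, hb⟩ := exists_ne (1 : B k)
  have hbu : ∀ x : B k, x ≠ 1 → x = b := fun x hx => h1 k hk x b hx hb
  have hbb : b * b = 1 := by
    by_contra h
    exact hb (mul_eq_left.1 (hbu _ h))
  by_cases h4 : ∃ x z : B j, x ≠ 1 ∧ z ≠ 1 ∧ x ≠ z
  · obtain ⟨x, z, hx, hz, hxz⟩ := h4
    refine key (Subgroup.zpowers (of b)) k ?_ (card_zpowers_eq_two ?_ ?_) j hk.symm x z hx hz hxz
    · rw [Subgroup.zpowers_le]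
      exact ⟨b, rfl⟩
    · exact fun h => hb (CoprodI.of_injective k (h.trans (map_one _).symm))
    · rw [← map_mul, hbb, map_one]
  push Not at h4
  have : Finite L := Nat.finite_of_card_ne_zero (by rw [h2]; norm_num)
  have : Nontrivial L := Finite.one_lt_card_iff_nontrivial.1 (by rw [h2]; norm_num)
  obtain ⟨⟨g, hg⟩, hg1⟩ := exists_ne (1 : L)
  obtain ⟨a, rfl⟩ := hL hg
  have ha : a ≠ 1 := by
    rintro rfl
    exact hg1 (Subtype.ext (map_one _))
  refine absurd ⟨j, k, hk.symm, ⟨a, ha, fun x hx => h4 x a hx ha⟩, ⟨b, hb, hbu⟩, ?_⟩ hD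
  intro l hlj hlk
  exact h3 k l hk hlj hlk.symm hnk

/-- The commutators of elements of distinct factors generate a subgroup of rank two that meets
the conjugates of the factors trivially. -/
theorem hasRatio_one {j k : J} (hjk : j ≠ k) {a : B j} {b : B k} (ha : a ≠ 1) (hb : b ≠ 1)
    (hbb : b * b ≠ 1) : HasRatio B 1 := by
  classical
  set α : CoprodI B := of a
  set β : CoprodI B := of b
  set c := α * β * α⁻¹ * β⁻¹ with hc
  set d := α * (β * β) * α⁻¹ * (β * β)⁻¹ with hd
  have hncomm : ¬ Commute c d := by
    intro hcd
    have A : IsReduced j j 1 α := isReduced_of ha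
    have A' := A.inv
    have C : IsReduced k k 1 β := isReduced_of hb
    have C' := C.inv
    have D : IsReduced k k 1 (β * β) := by
      have := isReduced_of (B := B) hbb
      rwa [map_mul] at this
    have D' := D.inv
    have hkj := hjk.symm
    -- After merging `(β * β)⁻¹ * β` into `β⁻¹`, the commutator of `c` and `d` is a reduced word of
    -- fifteen letters, hence nontrivial. The hypothesis `hbb` makes `β * β` a genuine letter.
    have h1 := ((((((((((((((A.mul hjk C).mul hkj A').mul hjk C').mul hkj A).mul hjk D).mul hkj
      A').mul hjk C').mul hkj A).mul hjk C').mul hkj A').mul hjk D).mul hkj A).mul hjk D').mul hkj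
      A').le_syllables
    have h2 : α * β * α⁻¹ * β⁻¹ * α * (β * β) * α⁻¹ * β⁻¹ * α * β⁻¹ * α⁻¹ * (β * β) * α *
        (β * β)⁻¹ * α⁻¹ = c * d * (d * c)⁻¹ := by
      simp [hc, hd, mul_assoc]
    rw [h2, hcd.eq, mul_inv_cancel, syllables_one] at h1
    omega
  set H := Subgroup.closure {c, d} with hH
  have hrank : rank H = 2 := by
    apply le_antisymm
    · refine (rank_le_encard (S := {c, d}) rfl).trans ?_
      exact (Set.encard_insert_le {d} c).trans (by rw [Set.encard_singleton]; norm_num)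
    · exact two_le_rank_of_not_commute (Subgroup.subset_closure (by simp))
        (Subgroup.subset_closure (by simp)) hncomm
  have hmeets : MeetsFactorsTrivially H := by
    intro h hh i x hx
    -- The retraction onto the factor `B i` kills at least one of `α`, `β`, hence both commutators,
    -- while it is injective on that factor.
    let π : CoprodI B →* B i := CoprodI.lift (Pi.mulSingle i (MonoidHom.id (B i)))
    have hπ : ∀ l, l ≠ i → ∀ z : B l, π (of z) = 1 := by
      intro l hl z
      simp only [π, CoprodI.lift_of]
      rw [Pi.mulSingle_eq_of_ne hl, MonoidHom.one_apply]
    have hker : H ≤ π.ker := by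
      rw [hH, Subgroup.closure_le]
      have hαβ : π α = 1 ∨ π β = 1 := by
        by_cases hji : j = i
        · exact Or.inr (hπ k (fun hki => hjk (hji.trans hki.symm)) b)
        · exact Or.inl (hπ j hji a)
      rintro g (rfl | rfl)
      · change π c = 1
        rcases hαβ with h | h <;> simp [hc, h]
      · change π d = 1
        rcases hαβ with h | h <;> simp [hd, h]
    have h1 := π.map_isConj hx
    rw [MonoidHom.mem_ker.1 (hker hh), isConj_comm, isConj_one_left] at h1
    have h2 : π (of x) = x := by
      simp only [π, CoprodI.lift_of, Pi.mulSingle_eq_same, MonoidHom.id_apply]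
    rw [h2] at h1
    rw [h1, map_one, isConj_comm, isConj_one_right] at hx
    exact hx
  have hred : reducedRank H = 1 := by
    rw [reducedRank, hrank]; rfl
  refine ⟨H, H, ⟨{c, d}, by simp [hH]⟩, ⟨{c, d}, by simp [hH]⟩, hmeets, hmeets, ?_, ?_⟩
  · rw [hred]; simp
  · rw [inf_idem, hred]; simp

end Positions

/-! ### The possible finite heights. -/

section Height

theorem height_le {G : Type*} [Group G] {L : Subgroup G} {n : ℕ} (hn : 3 ≤ n)
    (hL : Nat.card L = n) : height G ≤ n := by
  have : Finite L := Nat.finite_of_card_ne_zero (by omega)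
  have h1 : ENat.card L = n := by
    rw [ENat.card_eq_coe_natCard, hL]
  exact sInf_le ⟨L, by rw [h1]; exact_mod_cast hn, h1⟩

/-- A finite group of order at least three contains a subgroup of order four, if it is a 2-group, or
of odd prime order by Cauchy; a subgroup realizing the height must therefore itself have such an
order. -/
theorem exists_card_eq_height {G : Type*} [Group G] (h : height G ≠ ⊤) :
    ∃ n : ℕ, height G = n ∧ (n = 4 ∨ n.Prime ∧ n ≠ 2) ∧ ∃ L : Subgroup G, Nat.card L = n := by
  have hne : {n : ℕ∞ | ∃ L : Subgroup G, 3 ≤ ENat.card L ∧ ENat.card L = n}.Nonempty := by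
    by_contra hemp
    rw [Set.not_nonempty_iff_eq_empty] at hemp
    exact h (by rw [height, hemp, sInf_empty])
  obtain ⟨L, hL3, hLh⟩ := csInf_mem hne
  change ENat.card L = height G at hLh
  have hfin : Finite L := by
    by_contra hinf
    rw [not_finite_iff_infinite] at hinf
    exact h (by rw [← hLh, ENat.card_eq_top_of_infinite])
  set n := Nat.card L with hn
  have hLn : ENat.card L = n := ENat.card_eq_coe_natCard L
  have hh : height G = n := by rw [← hLh, hLn]
  have hn3 : 3 ≤ n := by
    rw [hLn] at hL3
    exact_mod_cast hL3
  have hmin : ∀ K : Subgroup L, 3 ≤ Nat.card K → n ≤ Nat.card K := by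
    intro K hK
    have h1 : Nat.card (K.map L.subtype) = Nat.card K :=
      (Nat.card_congr (K.equivMapOfInjective _ L.subtype_injective).toEquiv).symm
    have h2 := height_le hK h1
    rw [hh] at h2
    exact_mod_cast h2
  refine ⟨n, hh, ?_, L, rfl⟩
  rcases Nat.eq_two_pow_or_exists_odd_prime_and_dvd n with ⟨k, hk⟩ | ⟨p, hp, hpn, hodd⟩
  · left
    have hk2 : 2 ≤ k := by
      by_contra! hk2
      interval_cases k <;> omega
    have : Fact (Nat.Prime 2) := ⟨Nat.prime_two⟩
    obtain ⟨K, hK⟩ := Sylow.exists_subgroup_card_pow_prime (G := L) 2 (n := 2)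
      (by rw [← hn, hk]; exact pow_dvd_pow 2 hk2)
    have h1 := hmin K (by rw [hK]; norm_num)
    rw [hK] at h1
    have h2 : 2 ^ 2 ≤ 2 ^ k := Nat.pow_le_pow_right (by norm_num) hk2
    omega
  · right
    have : Fact p.Prime := ⟨hp⟩
    obtain ⟨g, hg⟩ := exists_prime_orderOf_dvd_card' (G := L) p hpn
    have hp3 : 3 ≤ p := by
      have := hp.two_le
      rcases hodd with ⟨m, hm⟩
      omega
    have h1 := hmin (Subgroup.zpowers g) (by rw [Nat.card_zpowers, hg]; exact hp3)
    rw [Nat.card_zpowers, hg] at h1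
    have h2 : n = p := le_antisymm h1 (Nat.le_of_dvd (by omega) hpn)
    rw [h2]
    exact ⟨hp, by omega⟩

theorem psi_natCast {n : ℕ} (hn : 3 ≤ n) : psi n = ENNReal.ofReal (n / (n - 2)) := by
  have h1 : (3 : ℝ) ≤ n := by exact_mod_cast hn
  rw [psi, if_neg (ENNReal.natCast_ne_top n), ENNReal.ofReal_div_of_pos (by linarith),
    ENNReal.ofReal_sub _ (by norm_num), ENNReal.ofReal_natCast]
  simp

end Height

/-! ### Choice of the subgroups according to height and involutions. -/

section Main

variable {J : Type*} {B : J → Type*} [∀ j, Group (B j)]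

theorem commute_of_card {G : Type*} [Group G] {L : Subgroup G} {n : ℕ}
    (hn : n = 4 ∨ n.Prime) (hL : Nat.card L = n) : ∀ g ∈ L, ∀ h ∈ L, Commute g h := by
  have key : ∀ g h : L, g * h = h * g := by
    rcases hn with rfl | hn
    · have : Fact (Nat.Prime 2) := ⟨Nat.prime_two⟩
      exact (IsPGroup.isMulCommutative_of_card_eq_prime_sq (p := 2) (G := L)
        (by rw [hL]; norm_num)).is_comm.comm
    · have : Fact n.Prime := ⟨hn⟩
      have : IsCyclic L := isCyclic_of_prime_card hL
      exact (IsCyclic.isMulCommutative (α := L)).is_comm.comm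
  exact fun g hg h hh => congrArg Subtype.val (key ⟨g, hg⟩ ⟨h, hh⟩)

theorem exists_le_factorRange_of_card [Nonempty J] {L : Subgroup (CoprodI B)} {n : ℕ}
    (hn : n = 4 ∨ n.Prime) (hL : Nat.card L = n) :
    ∃ (j : J) (L' : Subgroup (CoprodI B)), L' ≤ factorRange B j ∧ Nat.card L' = n := by
  have h2 : 2 ≤ n := by
    rcases hn with rfl | hn
    · norm_num
    · exact hn.two_le
  have : Finite L := Nat.finite_of_card_ne_zero (by omega)
  have : Nontrivial L := Finite.one_lt_card_iff_nontrivial.1 (by omega)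
  obtain ⟨j, L', h1, h3⟩ := exists_conj_le_factorRange (commute_of_card hn hL)
  exact ⟨j, L', h1, h3.trans hL⟩

/-- The lower bound for nondegenerate free products. -/
theorem hasRatio_beta_mul_psiHeight [Nonempty J] (hnt : ∀ j, ∃ k ≠ j, Nontrivial (B k))
    (hD : ¬ IsInfiniteDihedral B) :
    HasRatio B (beta (CoprodI B) * psiHeight (CoprodI B)) := by
  by_cases htop : height (CoprodI B) = ⊤
  · rw [psiHeight, htop, psi, ENat.toENNReal_top, if_pos rfl, mul_one, beta]
    split_ifs with h2
    · obtain ⟨L, hL⟩ := h2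
      obtain ⟨j, L', hj, hL'⟩ := exists_le_factorRange_of_card (Or.inr Nat.prime_two) hL
      exact hasRatio_two_of_card_eq_two hnt hD hj hL'
    · obtain ⟨k, -, _⟩ := hnt (Classical.arbitrary J)
      obtain ⟨j, hj, _⟩ := hnt k
      obtain ⟨a, ha⟩ := exists_ne (1 : B j)
      obtain ⟨b, hb⟩ := exists_ne (1 : B k)
      refine hasRatio_one hj ha hb fun hbb => h2 ⟨Subgroup.zpowers (of b), ?_⟩
      refine card_zpowers_eq_two ?_ (by rw [← map_mul, hbb, map_one])
      exact fun h => hb (CoprodI.of_injective k (h.trans (map_one _).symm))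
  · obtain ⟨n, hn, hn', L, hL⟩ := exists_card_eq_height htop
    have hn3 : 3 ≤ n := by
      rcases hn' with rfl | ⟨h1, h2⟩
      · norm_num
      · have := h1.two_le
        omega
    obtain ⟨j, L', hj, hL'⟩ := exists_le_factorRange_of_card (hn'.imp_right And.left) hL
    rw [psiHeight, hn, ENat.toENNReal_coe, psi_natCast hn3, beta]
    split_ifs with h2
    · obtain ⟨S, hS⟩ := h2
      obtain ⟨k, S', hk, hS'⟩ := exists_le_factorRange_of_card (Or.inr Nat.prime_two) hS
      obtain ⟨M, y, i, hM, hM1, hM2⟩ := exists_goodPosition_pair hk hj hnt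
      rw [hS'] at hM1
      rw [hL'] at hM2
      have h3 : (2 : ℝ≥0∞) * ENNReal.ofReal (n / (n - 2)) =
          ENNReal.ofReal (2 * n / (n - 2)) := by
        rw [mul_div_assoc, ENNReal.ofReal_mul (by norm_num)]
        simp
      rw [h3]
      rcases hn' with rfl | ⟨hp, hp2⟩
      · exact hM.hasRatio_of_card_two_four hM1 hM2
      · exact hM.hasRatio_of_card_two_prime hp hp2 hM1 hM2
    · rw [one_mul]
      rcases hn' with rfl | ⟨hp, hp2⟩
      -- A group of order four contains an involution, contrary to `h2`.
      · exfalso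
        have : Finite L := Nat.finite_of_card_ne_zero (by omega)
        have : Fact (Nat.Prime 2) := ⟨Nat.prime_two⟩
        obtain ⟨g, hg⟩ := exists_prime_orderOf_dvd_card' (G := L) 2 (by rw [hL]; norm_num)
        exact h2 ⟨Subgroup.zpowers (g : CoprodI B), by
          rw [Nat.card_zpowers, Subgroup.orderOf_coe, hg]⟩
      · obtain ⟨M, y, i, hM, hM1, hM2⟩ := exists_goodPosition_pair hj hj hnt
        refine hM.hasRatio_of_card_eq_prime hp hp2 ?_
        rintro (_ | _)
        · exact hM2.trans hL'
        · exact hM1.trans hL'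

end Main

/-! ### Invariance under isomorphism. -/

section Transport

theorem height_le_of_mulEquiv {G G' : Type*} [Group G] [Group G'] (e : G ≃* G') :
    height G' ≤ height G := by
  refine le_sInf ?_
  rintro _ ⟨L, hL, rfl⟩
  have h1 : ENat.card (L.map e.toMonoidHom) = ENat.card L :=
    (ENat.card_congr (L.equivMapOfInjective e.toMonoidHom e.injective).toEquiv).symm
  exact sInf_le ⟨L.map e.toMonoidHom, by rwa [h1], h1⟩

theorem height_congr {G G' : Type*} [Group G] [Group G'] (e : G ≃* G') : height G = height G' :=
  le_antisymm (height_le_of_mulEquiv e.symm) (height_le_of_mulEquiv e)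

theorem exists_card_two_of_mulEquiv {G G' : Type*} [Group G] [Group G'] (e : G ≃* G')
    (h : ∃ L : Subgroup G, Nat.card L = 2) : ∃ L : Subgroup G', Nat.card L = 2 := by
  obtain ⟨L, hL⟩ := h
  refine ⟨L.map e.toMonoidHom, ?_⟩
  rw [← hL]
  exact (Nat.card_congr (L.equivMapOfInjective e.toMonoidHom e.injective).toEquiv).symm

theorem beta_congr {G G' : Type*} [Group G] [Group G'] (e : G ≃* G') : beta G = beta G' := by
  have : (∃ L : Subgroup G, Nat.card L = 2) ↔ ∃ L : Subgroup G', Nat.card L = 2 :=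
    ⟨exists_card_two_of_mulEquiv e, exists_card_two_of_mulEquiv e.symm⟩
  unfold beta
  split_ifs <;> tauto

end Transport

/-! ### Replacing the free factor by infinite cyclic factors. -/

section Splitting

universe u v w

variable (F : Type u) [Group F] [IsFreeGroup F] {I : Type v} (A : I → Type w)
  [∀ i, Group (A i)]

/-- The factors of the free product, with one infinite cyclic factor for each free generator. -/
abbrev splitFactor : IsFreeGroup.Generators F ⊕ I → Type w
  | .inl _ => ULift.{w} (Multiplicative ℤ)
  | .inr i => A i

instance : ∀ j, Group (splitFactor F A j)
  | .inl _ => inferInstanceAs (Group (ULift.{w} (Multiplicative ℤ)))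
  | .inr i => inferInstanceAs (Group (A i))

/-- The embedding of the factors with index in `I`. -/
abbrev ofFactor (i : I) : A i →* CoprodI (splitFactor F A) :=
  of (M := splitFactor F A) (i := .inr i)

/-- The embedding of the cyclic factors. -/
abbrev ofGenerator (x : IsFreeGroup.Generators F) :
    ULift.{w} (Multiplicative ℤ) →* CoprodI (splitFactor F A) :=
  of (M := splitFactor F A) (i := .inl x)

/-- The homomorphism splitting the free factor into cyclic factors. -/
noncomputable def toSplit : FreeProd F A →* CoprodI (splitFactor F A) :=
  Coprod.lift
    (IsFreeGroup.lift fun x => ofGenerator F A x ⟨Multiplicative.ofAdd 1⟩)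
    (CoprodI.lift fun i => ofFactor F A i)

/-- The homomorphism assembling the cyclic factors into the free factor. -/
noncomputable def ofSplit : CoprodI (splitFactor F A) →* FreeProd F A :=
  CoprodI.lift fun j =>
    match j with
    | .inl x => (zpowersHom (FreeProd F A) (Coprod.inl (IsFreeGroup.of x))).comp
        MulEquiv.ulift.toMonoidHom
    | .inr i => (Coprod.inr : CoprodI A →* FreeProd F A).comp (of (M := A) (i := i))

/-- A free product with a free factor is a free product of the other factors and of infinite cyclic
groups. -/
noncomputable def splitEquiv : FreeProd F A ≃* CoprodI (splitFactor F A) :=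
  MonoidHom.toMulEquiv (toSplit F A) (ofSplit F A)
    (by
      apply Coprod.hom_ext
      · apply IsFreeGroup.ext_hom
        intro x
        simp [toSplit, ofSplit]
        exact zpow_one _
      · apply CoprodI.ext_hom
        intro i
        ext a
        simp [toSplit, ofSplit])
    (by
      apply CoprodI.ext_hom
      rintro (x | i)
      · apply MonoidHom.ext
        rintro ⟨n⟩
        simp [toSplit, ofSplit]
        rw [← map_zpow]
        refine congrArg (ofGenerator F A x) (ULift.ext _ _ ?_)
        change Multiplicative.ofAdd (1 : ℤ) ^ Multiplicative.toAdd n = n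
        rw [← ofAdd_zsmul, smul_eq_mul, mul_one, ofAdd_toAdd]
      · ext a
        simp [toSplit, ofSplit])

theorem splitEquiv_inr_of {i : I} (a : A i) :
    splitEquiv F A (Coprod.inr (of a)) = ofFactor F A i a := by
  have h : ⇑(splitEquiv F A) = toSplit F A := rfl
  rw [h, toSplit, Coprod.lift_apply_inr, CoprodI.lift_of]

variable {F A}

theorem mem_family_iff {H : Subgroup (FreeProd F A)} : H ∈ family F A ↔ H.FG ∧
    ∀ h ∈ H, ∀ (i : I) (a : A i), IsConj (splitEquiv F A h) (ofFactor F A i a) → h = 1 := by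
  refine and_congr_right fun _ => ⟨fun hH h hh i a hc => ?_, fun hH g i => ?_⟩
  · rw [← splitEquiv_inr_of] at hc
    obtain ⟨c, hc⟩ := isConj_iff.1 hc
    obtain ⟨c, rfl⟩ := (splitEquiv F A).surjective c
    rw [← map_inv, ← map_mul, ← map_mul, EmbeddingLike.apply_eq_iff_eq] at hc
    have h1 : h ∈ H ⊓ (factor F A i).map (MulAut.conj c⁻¹).toMonoidHom := by
      refine ⟨hh, _, ⟨a, rfl⟩, ?_⟩
      change c⁻¹ * Coprod.inr (of a) * c⁻¹⁻¹ = h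
      rw [← hc]
      group
    rw [hH] at h1
    exact h1
  · rw [eq_bot_iff]
    rintro h ⟨hh, _, ⟨a, rfl⟩, hg⟩
    refine hH h hh i a ?_
    rw [← splitEquiv_inr_of, isConj_comm, isConj_iff]
    refine ⟨splitEquiv F A g⁻¹, ?_⟩
    rw [← map_inv, ← map_mul, ← map_mul, ← hg]
    rfl

/-- `MeetsFactorsTrivially` also concerns the cyclic factors coming from `F`, so it is stronger than
membership in `family` requires. -/
theorem HasRatio.le_sigma {x : ℝ≥0∞} (h : HasRatio (splitFactor F A) x) :
    x ≤ sigma (family F A) := by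
  obtain ⟨H, K, hH, hK, hHm, hKm, hne, hx⟩ := h
  let e : CoprodI (splitFactor F A) →* FreeProd F A := (splitEquiv F A).symm.toMonoidHom
  have he : Function.Injective e := (splitEquiv F A).symm.injective
  have hred : ∀ N : Subgroup (CoprodI (splitFactor F A)),
      reducedRank (N.map e) = reducedRank N := fun N => by
    rw [reducedRank, reducedRank, rank_map e he]
  have hmem : ∀ N : Subgroup (CoprodI (splitFactor F A)), N.FG → MeetsFactorsTrivially N →
      N.map e ∈ family F A := by
    intro N hN hNm
    rw [mem_family_iff]
    refine ⟨fg_map e hN, ?_⟩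
    rintro _ ⟨n, hn, rfl⟩ i a hc
    have h1 : splitEquiv F A (e n) = n := (splitEquiv F A).apply_symm_apply n
    rw [h1] at hc
    rw [hNm n hn _ _ hc, map_one]
  refine hx.trans (le_sSup ⟨H.map e, hmem H hH hHm, K.map e, hmem K hK hKm, ?_, ?_⟩)
  · rwa [hred, hred]
  · rw [← Subgroup.map_inf _ _ _ he, hred, hred, hred]

theorem rank_map_splitEquiv (H : Subgroup (FreeProd F A)) :
    rank (H.map (splitEquiv F A).toMonoidHom) = rank H :=
  rank_map _ (splitEquiv F A).injective H

end Splitting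

/-! ### Excluding the degenerate free products. -/

section Degenerate

theorem exists_of_eq_of_subsingleton {J : Type*} {B : J → Type*} [∀ j, Group (B j)] {j : J}
    (hj : ∀ k ≠ j, Subsingleton (B k)) (g : CoprodI B) : ∃ b : B j, of b = g := by
  induction g using CoprodI.induction_on with
  | one => exact ⟨1, map_one _⟩
  | of k m =>
    by_cases hk : k = j
    · subst hk
      exact ⟨m, rfl⟩
    · have := hj k hk
      exact ⟨1, by rw [Subsingleton.elim m 1, map_one, map_one]⟩
  | mul x y hx hy =>
    obtain ⟨b, rfl⟩ := hx
    obtain ⟨c, rfl⟩ := hy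
    exact ⟨b * c, map_mul _ _ _⟩

/-- Every element is a rotation `(α * β) ^ n` or a reflection `(α * β) ^ n * α`; the latter is
conjugate to `α` for even `n` and to `β` for odd `n`. -/
theorem mem_zpowers_of_dihedral {G : Type*} [Group G] {α β : G} (hα : α * α = 1)
    (hβ : β * β = 1) {g : G} (hg : g ∈ Subgroup.closure {α, β}) (h1 : ¬ IsConj g α)
    (h2 : ¬ IsConj g β) : g ∈ Subgroup.zpowers (α * β) := by
  have hαi : α⁻¹ = α := inv_eq_of_mul_eq_one_right hα
  have hβi : β⁻¹ = β := inv_eq_of_mul_eq_one_right hβ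
  have hsemi : ∀ n : ℤ, α * (α * β) ^ n = (α * β) ^ (-n) * α := by
    intro n
    have h : SemiconjBy α (α * β) (α * β)⁻¹ := by
      change α * (α * β) = (α * β)⁻¹ * α
      rw [mul_inv_rev, hαi, hβi, ← mul_assoc, hα, one_mul, mul_assoc, hα, mul_one]
    have := (h.zpow_right n).eq
    rwa [inv_zpow'] at this
  have key : ∃ n : ℤ, g = (α * β) ^ n ∨ g = (α * β) ^ n * α := by
    clear h1 h2
    induction hg using Subgroup.closure_induction with
    | mem x hx =>
      rcases hx with rfl | rfl
      · exact ⟨0, Or.inr (by simp)⟩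
      · refine ⟨-1, Or.inr ?_⟩
        rw [← hsemi, zpow_one, ← mul_assoc, hα, one_mul]
    | one => exact ⟨0, Or.inl (by simp)⟩
    | mul x y _ _ hx hy =>
      obtain ⟨m, rfl | rfl⟩ := hx <;> obtain ⟨n, rfl | rfl⟩ := hy
      · exact ⟨m + n, Or.inl (zpow_add _ _ _).symm⟩
      · exact ⟨m + n, Or.inr (by rw [zpow_add, mul_assoc])⟩
      · exact ⟨m + -n, Or.inr (by rw [zpow_add, mul_assoc, hsemi, mul_assoc])⟩
      · refine ⟨m + -n, Or.inl ?_⟩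
        rw [zpow_add, mul_assoc, ← mul_assoc α, hsemi, mul_assoc _ α α, hα, mul_one]
    | inv x _ hx =>
      obtain ⟨m, rfl | rfl⟩ := hx
      · exact ⟨-m, Or.inl (zpow_neg _ _).symm⟩
      · refine ⟨m, Or.inr ?_⟩
        rw [mul_inv_rev, hαi, ← zpow_neg, hsemi, neg_neg]
  obtain ⟨n, rfl | rfl⟩ := key
  · exact ⟨n, rfl⟩
  · exfalso
    rcases Int.even_or_odd' n with ⟨m, rfl | rfl⟩
    · refine h1 (isConj_iff.2 ⟨(α * β) ^ (-m), ?_⟩)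
      rw [← zpow_neg, neg_neg, mul_assoc, mul_assoc, hsemi, ← mul_assoc, ← mul_assoc, ← zpow_add,
        ← zpow_add]
      rw [show -m + 2 * m + -m = 0 by ring, zpow_zero, one_mul]
    · refine h2 (isConj_iff.2 ⟨α * (α * β) ^ (-m), ?_⟩)
      rw [mul_inv_rev, hαi, ← zpow_neg, neg_neg]
      have h3 : α * (α * β) ^ (-m) * ((α * β) ^ (2 * m + 1) * α) * ((α * β) ^ m * α) =
          α * ((α * β) ^ (-m) * (α * β) ^ (2 * m + 1) * (α * (α * β) ^ m)) * α := by
        simp only [mul_assoc]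
      rw [h3, hsemi, ← mul_assoc ((α * β) ^ (-m) * (α * β) ^ (2 * m + 1)), ← zpow_add,
        ← zpow_add, show -m + (2 * m + 1) + -m = 1 by ring, zpow_one]
      simp only [mul_assoc, hα, mul_one]
      rw [← mul_assoc, hα, one_mul]

section Nondegenerate

universe u v w

variable {F : Type u} [Group F] [IsFreeGroup F] {I : Type v} {A : I → Type w}
  [∀ i, Group (A i)]

/-- With at most one nontrivial factor the whole group is trivial, infinite cyclic or some `A i`,
and in the last case members of the family are trivial. None of these leaves room for rank two. -/
theorem not_exists_subsingleton_factors (hF : ∃ H ∈ family F A, 2 ≤ rank H) :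
    Nonempty (IsFreeGroup.Generators F ⊕ I) ∧
      ∀ j, ∃ k ≠ j, Nontrivial (splitFactor F A k) := by
  obtain ⟨H, hH, hr⟩ := hF
  rw [mem_family_iff] at hH
  have hcyc : ∀ [IsCyclic (H.map (splitEquiv F A).toMonoidHom)], False := by
    intro _
    have h1 := rank_le_one_of_isCyclic (H.map (splitEquiv F A).toMonoidHom)
    rw [rank_map_splitEquiv] at h1
    exact absurd (hr.trans h1) (by norm_num)
  refine ⟨?_, fun j => ?_⟩
  · by_contra hemp
    rw [not_nonempty_iff] at hemp
    have h1 : ∀ g : CoprodI (splitFactor F A), g = 1 := by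
      intro g
      induction g using CoprodI.induction_on with
      | one => rfl
      | of k m => exact (hemp.false k).elim
      | mul x y hx hy => rw [hx, hy, one_mul]
    have : Subsingleton (CoprodI (splitFactor F A)) := ⟨fun g h => (h1 g).trans (h1 h).symm⟩
    exact hcyc
  · by_contra! hj
    have hall := exists_of_eq_of_subsingleton (B := splitFactor F A) hj
    rcases j with x | i
    · have : IsCyclic (CoprodI (splitFactor F A)) := by
        have : IsCyclic (ULift.{w} (Multiplicative ℤ)) :=
          isCyclic_of_surjective MulEquiv.ulift.symm MulEquiv.ulift.symm.surjective
        exact isCyclic_of_surjective (ofGenerator F A x) hall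
      exact hcyc
    · have h1 : H = ⊥ := by
        rw [eq_bot_iff]
        intro h hh
        obtain ⟨a, ha⟩ := hall (splitEquiv F A h)
        exact hH.2 h hh i a (by rw [← ha])
      have : IsCyclic (H.map (splitEquiv F A).toMonoidHom) := by
        rw [h1, Subgroup.map_bot]
        infer_instance
      exact hcyc

/-- Both factors of order two must be among the `A i`. A member of the family then contains no
reflection, so it lies in the cyclic group of rotations and has rank at most one. -/
theorem not_isInfiniteDihedral (hF : ∃ H ∈ family F A, 2 ≤ rank H) :
    ¬ IsInfiniteDihedral (splitFactor F A) := by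
  rintro ⟨j, k, hjk, ⟨a, ha, hau⟩, ⟨b, hb, hbu⟩, hl⟩
  obtain ⟨H, hH, hr⟩ := hF
  rw [mem_family_iff] at hH
  have hinl : ∀ (x : IsFreeGroup.Generators F) (c : splitFactor F A (.inl x)),
      ¬ ∀ z : splitFactor F A (.inl x), z ≠ 1 → z = c := by
    intro x c hc
    have h1 := hc ⟨Multiplicative.ofAdd 1⟩ (fun h => by
      have := congrArg (fun z => Multiplicative.toAdd (ULift.down z)) h
      exact one_ne_zero this)
    have h2 := hc ⟨Multiplicative.ofAdd 2⟩ (fun h => by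
      have := congrArg (fun z => Multiplicative.toAdd (ULift.down z)) h
      exact two_ne_zero this)
    have h3 := congrArg (fun z => Multiplicative.toAdd (ULift.down z)) (h1.trans h2.symm)
    exact absurd h3 (by decide)
  rcases j with x | i
  · exact hinl x a hau
  rcases k with x | i'
  · exact hinl x b hbu
  have hsq : ∀ {G : Type w} [Group G] {c : G}, c ≠ 1 → (∀ z : G, z ≠ 1 → z = c) → c * c = 1 := by
    intro G _ c hc hcu
    by_contra h
    exact hc (mul_eq_left.1 (hcu _ h))
  set α := ofFactor F A i a
  set β := ofFactor F A i' b
  have hα : α * α = 1 := by rw [← map_mul, hsq ha hau, map_one]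
  have hβ : β * β = 1 := by rw [← map_mul, hsq hb hbu, map_one]
  have htop : ∀ g : CoprodI (splitFactor F A), g ∈ Subgroup.closure {α, β} := by
    intro g
    induction g using CoprodI.induction_on with
    | one => exact one_mem _
    | of l m =>
      by_cases hm : m = 1
      · rw [hm, map_one]
        exact one_mem _
      by_cases hlj : l = .inr i
      · subst hlj
        rw [hau m hm]
        exact Subgroup.subset_closure (Or.inl rfl)
      by_cases hlk : l = .inr i'
      · subst hlk
        rw [hbu m hm]
        exact Subgroup.subset_closure (Or.inr rfl)
      have := hl l hlj hlk
      exact absurd (Subsingleton.elim m 1) hm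
    | mul x y hx hy => exact mul_mem hx hy
  have hα1 : α ≠ 1 := fun h => ha (CoprodI.of_injective _ (h.trans (map_one _).symm))
  have hβ1 : β ≠ 1 := fun h => hb (CoprodI.of_injective _ (h.trans (map_one _).symm))
  have hle : H.map (splitEquiv F A).toMonoidHom ≤ Subgroup.zpowers (α * β) := by
    rintro _ ⟨h, hh, rfl⟩
    refine mem_zpowers_of_dihedral hα hβ (htop _) (fun hc => ?_) (fun hc => ?_)
    · have h1 := hH.2 h hh i a hc
      rw [h1, map_one, isConj_one_right] at hc
      exact hα1 hc
    · have h1 := hH.2 h hh i' b hc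
      rw [h1, map_one, isConj_one_right] at hc
      exact hβ1 hc
  have : IsCyclic (H.map (splitEquiv F A).toMonoidHom) := Subgroup.isCyclic_of_le hle
  have h1 := rank_le_one_of_isCyclic (H.map (splitEquiv F A).toMonoidHom)
  rw [rank_map_splitEquiv] at h1
  exact absurd (hr.trans h1) (by norm_num)

end Nondegenerate

end Degenerate

end KuroshFree

theorem mainTheorem3 {F : Type*} [Group F] [IsFreeGroup F]
    {I : Type*} (A : I → Type*) [∀ i, Group (A i)]
    (hF : ∃ H ∈ KuroshFree.family F A, 2 ≤ KuroshFree.rank H) :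
    KuroshFree.beta (KuroshFree.FreeProd F A) * KuroshFree.psiHeight (KuroshFree.FreeProd F A)
      ≤ KuroshFree.sigma (KuroshFree.family F A) := by
  obtain ⟨hne, hnt⟩ := KuroshFree.not_exists_subsingleton_factors hF
  have h := KuroshFree.hasRatio_beta_mul_psiHeight hnt (KuroshFree.not_isInfiniteDihedral hF)
  rw [KuroshFree.psiHeight, ← KuroshFree.beta_congr (KuroshFree.splitEquiv F A),
    ← KuroshFree.height_congr (KuroshFree.splitEquiv F A)] at h
  exact h.le_sigma
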